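/- **Setting.** Let $\lambda$ be Lebesgue measure on $\mathbb R^d$, and for a locally finite Borel measure $\mu$ on $\mathbb R^d$ put $\theta_t\mu(B)=\mu(B+t)$. Let $(E,\mathcal E)$ be a measurable space on which the additive group $\mathbb R^d$ acts measurably by maps $\theta_t$ (that is, $(t,x)\mapsto\theta_t x$ is measurable and defines a group action), and put $\theta_t(x,\mu)=(\theta_t x,\theta_t\mu)$. For a measure $\mu$ and a set $B$ with $0<\mu(B)<\infty$ write $\mu(\cdot\mid B)=\mu(\cdot\cap B)/\mu(B)$. Let $(\Omega,\mathcal F,P^\circ)$ be a measure space ($P^\circ$ need not be finite), let $X^\circ$ be a random element of $E$ and $\xi^\circ$ a random (locally finite) measure on $\mathbb R^d$, such that the distribution of $(X^\circ,\xi^\circ)$ under $P^\circ$ is $\sigma$-finite and such that, $P^\circ$-a.e., $0\in\operatorname{supp}\xi^\circ$ and the convex hull of $\operatorname{supp}\xi^\circ$ is $\mathbb R^d$. The pair $(X^\circ,\xi^\circ)$ is *mass-stationary* under $P^\circ$ if for every bounded Borel set $C$ with $\lambda(C)>0$ and $\lambda(\partial C)=0$ the pairs $(\theta_{V}(X^\circ,\xi^\circ),V+U)$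 and $((X^\circ,\xi^\circ),U)$ have the same distribution under $P^\circ$, where the conditional distribution of $U$ given $(X^\circ,\xi^\circ)$ is uniform on $C$ and the conditional distribution of $V$ given $((X^\circ,\xi^\circ),U)$ is $\xi^\circ(\cdot\mid C-U)$. A pair $(X,\xi)$ is *stationary* under $P$ if $\theta_t(X,\xi)$ and $(X,\xi)$ have the same distribution under $P$ for every $t\in\mathbb R^d$. The pair $(X^\circ,\xi^\circ)$ under $P^\circ$ is the *Palm version* of a stationary pair $(X,\xi)$ under $P$ if $$E^\circ[f(X^\circ,\xi^\circ)]=\frac1{\lambda(B)}\,E\Big[\int_B f(\theta_t(X,\xi))\,\xi(dt)\Big]$$ for every nonnegative measurable $f$ and every Borel set $B$ with $0<\lambda(B)<\infty$, where $E^\circ$ and $E$ denote integration with respect to $P^\circ$ and $P$. **Construction.** Let $T$ be a random vector in $\mathbb R^d$ whose conditional distribution under $P^\circ$ given $(X^\circ,\xi^\circ)$ is uniform on $[0,1)^d$. Let $N^\circ$ be the set of all $i\in\mathbb Z^d$ with $\theta_{-T}\xi^\circ(i+[0,1)^d)>0$. Partition $\mathbb Z^d$ into Voronoi cells by associating each $i\in\mathbb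 Z^d$ with the point of $N^\circ$ closest to $i$ in Euclidean distance, ties being resolved in favour of the lexicographically lowest point, and let $D^\circ$ be the cell containing $0$, with $|D^\circ|$ elements. Let $S$ be a random vector in $\mathbb Z^d$ whose conditional distribution under $P^\circ$ given $((X^\circ,\xi^\circ),T)$ is uniform on $D^\circ$. Put $$(X,\xi):=\theta_S\theta_{-T}(X^\circ,\xi^\circ),\qquad dP:=\frac{|D^\circ|}{\theta_{-T}\xi^\circ([0,1)^d)}\,dP^\circ .$$ **Theorem.** Suppose that $(X^\circ,\xi^\circ)$ is mass-stationary under $P^\circ$. Then, under $P$, the pair $(X,\xi)$ has a $\sigma$-finite distribution and is stationary, and the conditional distribution of $T$ given $(X,\xi)$ is $(\theta_{-S}\xi)(\cdot\mid[0,1)^d)$. Moreover, $(X^\circ,\xi^\circ)$ under $P^\circ$ is the Palm version of $(X,\xi)$ under $P$. -/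

import Mathlib

open MeasureTheory ProbabilityTheory
open scoped ENNReal

noncomputable section

namespace MassStat

/-- Euclidean space `ℝ^d`. -/
abbrev Space (d : ℕ) : Type := EuclideanSpace ℝ (Fin d)

/-- The lattice `ℤ^d`. -/
abbrev Lattice (d : ℕ) : Type := Fin d → ℤ

/-- A lattice point regarded as a point of `ℝ^d`. -/
def toSpace {d : ℕ} (i : Lattice d) : Space d := WithLp.toLp 2 (fun k => (i k : ℝ))

/-- The half-open unit cube `[0,1)^d`. -/
def unitCube (d : ℕ) : Set (Space d) := {x | ∀ k, 0 ≤ x k ∧ x k < 1}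

/-- The space of locally finite Borel measures on `ℝ^d`. It carries the `σ`-algebra generated by
the evaluations `μ ↦ μ B`; a random measure is a measurable map into this space. -/
abbrev LFMeasure (d : ℕ) : Type := {μ : Measure (Space d) // IsLocallyFiniteMeasure μ}

/-- Shifts of locally finite measures are locally finite. -/
theorem shift_locallyFinite {d : ℕ} (t : Space d) (μ : LFMeasure d) :
    IsLocallyFiniteMeasure ((μ : Measure (Space d)).map (fun x => x - t)) := by
  refine ⟨fun x => ?_⟩
  obtain ⟨U, hU, hfin⟩ := μ.2.finiteAtNhds (x + t)
  refine ⟨(fun y => y + t) ⁻¹' U,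
    (continuous_id.add continuous_const).continuousAt.preimage_mem_nhds hU, ?_⟩
  have h := (Homeomorph.subRight t).measurableEmbedding.map_apply (μ : Measure (Space d))
    ((fun y => y + t) ⁻¹' U)
  have e : (Homeomorph.subRight t) ⁻¹' ((fun y => y + t) ⁻¹' U) = U := by
    ext y
    simp
  rw [e] at h
  exact h.trans_lt hfin

/-- The shift `θ_t μ (B) = μ (B + t)`, the image of `μ` under `x ↦ x - t`. -/
instance {d : ℕ} : VAdd (Space d) (LFMeasure d) where
  vadd t μ := ⟨(μ : Measure (Space d)).map (fun x => x - t), shift_locallyFinite t μ⟩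

theorem coe_shift {d : ℕ} (t : Space d) (μ : LFMeasure d) :
    ((t +ᵥ μ : LFMeasure d) : Measure (Space d)) =
      (μ : Measure (Space d)).map (fun x => x - t) := rfl

/-- The shifts form an action of the additive group `ℝ^d`. -/
instance {d : ℕ} : AddAction (Space d) (LFMeasure d) where
  zero_vadd μ := Subtype.ext (by simp [coe_shift])
  add_vadd s t μ := Subtype.ext (by
    rw [coe_shift, coe_shift, coe_shift, Measure.map_map (by fun_prop) (by fun_prop)]
    congr 1
    funext x
    simp only [Function.comp_apply]
    abel)

/-- The shift in the form `θ_t μ (B) = μ (B + t)`. -/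
theorem shift_apply {d : ℕ} (t : Space d) (μ : LFMeasure d) {B : Set (Space d)}
    (hB : MeasurableSet B) :
    ((t +ᵥ μ : LFMeasure d) : Measure (Space d)) B =
      (μ : Measure (Space d)) ((fun y => y + t) '' B) := by
  rw [coe_shift, Measure.map_apply (by fun_prop) hB]
  congr 1
  ext x
  simp only [Set.mem_preimage, Set.mem_image]
  exact ⟨fun h => ⟨x - t, h, by abel⟩, by rintro ⟨y, hy, rfl⟩; simpa using hy⟩

/-- The lattice points `i` such that the cube `i + [0,1)^d` has positive mass. -/
def occupied {d : ℕ} (μ : LFMeasure d) : Set (Lattice d) :=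
  {i | 0 < (μ : Measure (Space d)) ((fun x => toSpace i + x) '' unitCube d)}

/-- `n` is the point of `N` to which the lattice point `i` is associated: it has minimal Euclidean
distance to `i`, and it is the lexicographically lowest among the points of `N` with minimal
distance to `i`. -/
def IsCentre {d : ℕ} (N : Set (Lattice d)) (i n : Lattice d) : Prop :=
  n ∈ N ∧ ∀ m ∈ N, dist (toSpace i) (toSpace n) < dist (toSpace i) (toSpace m) ∨
    (dist (toSpace i) (toSpace n) = dist (toSpace i) (toSpace m) ∧ toLex n ≤ toLex m)

/-- The Voronoi cell (in `ℤ^d`, with respect to `N`) that contains `0`: all lattice points that are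
associated to the same point of `N` as `0`. -/
def originCell {d : ℕ} (N : Set (Lattice d)) : Set (Lattice d) :=
  {i | ∃ n, IsCentre N 0 n ∧ IsCentre N i n}

/-- Under `P`, the conditional distribution of `Z` given `Y` is the random measure `κ`. -/
def HasCondDistrib {Ω 𝒴 𝒵 : Type*} [MeasurableSpace Ω] [MeasurableSpace 𝒴] [MeasurableSpace 𝒵]
    (P : Measure Ω) (Z : Ω → 𝒵) (Y : Ω → 𝒴) (κ : Ω → Measure 𝒵) : Prop :=
  (∃ K : Kernel 𝒴 𝒵, ∀ᵐ ω ∂P, κ ω = K (Y ω)) ∧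
    ∀ (A : Set 𝒴) (B : Set 𝒵), MeasurableSet A → MeasurableSet B →
      P (Y ⁻¹' A ∩ Z ⁻¹' B) = ∫⁻ ω in Y ⁻¹' A, κ ω B ∂P

section Pairs

variable {d : ℕ} {Ω E : Type*} [MeasurableSpace Ω] [MeasurableSpace E] [AddAction (Space d) E]

/-- The pair `Y = (X, ξ)` is stationary under `P`: `θ_t (X, ξ)` and `(X, ξ)` have the same
distribution for every `t`. -/
def IsStationary (P : Measure Ω) (Y : Ω → E × LFMeasure d) : Prop :=
  ∀ t : Space d, IdentDistrib (fun ω => t +ᵥ Y ω) Y P P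

/-- The pair `Y = (X, ξ)` is mass-stationary under `P`: for every bounded Borel set `C` with
`λ(C) > 0` and `λ(∂C) = 0`, the pairs `(θ_V (X, ξ), V + U)` and `((X, ξ), U)` have the same
distribution, where `U` given `(X, ξ)` is uniform on `C`, and `V` given `((X, ξ), U)` has
distribution `ξ(· | C - U)`. The two distributions are written out as integrals of nonnegative
measurable functions. -/
def IsMassStationary (P : Measure Ω) (Y : Ω → E × LFMeasure d) : Prop :=
  ∀ C : Set (Space d), MeasurableSet C → Bornology.IsBounded C →
    0 < volume C → volume (frontier C) = 0 →
    ∀ f : (E × LFMeasure d) × Space d → ℝ≥0∞, Measurable f →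
      ∫⁻ ω, ∫⁻ u, ∫⁻ v, f (v +ᵥ Y ω, v + u)
          ∂(cond ((Y ω).2 : Measure (Space d)) ((fun y => y - u) '' C))
        ∂(cond (volume : Measure (Space d)) C) ∂P =
      ∫⁻ ω, ∫⁻ u, f (Y ω, u) ∂(cond (volume : Measure (Space d)) C) ∂P

/-- The pair `Y₀` under `P₀` is the Palm version of the pair `Y = (X, ξ)` under `P`. -/
def IsPalmVersion {Ω₀ : Type*} [MeasurableSpace Ω₀] (P₀ : Measure Ω₀)
    (Y₀ : Ω₀ → E × LFMeasure d) (P : Measure Ω) (Y : Ω → E × LFMeasure d) : Prop :=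
  ∀ f : E × LFMeasure d → ℝ≥0∞, Measurable f →
    ∀ B : Set (Space d), MeasurableSet B → 0 < volume B → volume B < ∞ →
      ∫⁻ ω, f (Y₀ ω) ∂P₀ =
        (∫⁻ ω, ∫⁻ t in B, f (t +ᵥ Y ω) ∂((Y ω).2 : Measure (Space d)) ∂P) / volume B

end Pairs

end MassStat

end

noncomputable section

namespace MassStat

section

variable {d : ℕ}

/-! Let Q be the law of the given pair. Choose y by Q and u by Lebesgue measure, and look at z =
θ_{-u}y, in which the old origin sits at u. Mass-stationarity, tested on balls that exhaust the
space, says that the measure Q(dy) du z(dx) is symmetric in u and x (`IsExchangeable`).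

Let w(z,·) be a probability density with respect to the random measure of z, here that of its
normalised restriction to the cube of the centre of 0 (`weight`), and define M by M(f) = ∫∫ w(z,u)
f(z) du Q(dy) (`IsInversion`). Exchanging u and x turns w(z,u)g(z,x) into w(z,x)g(z,u), and w
integrates out to 1. This is the refined Campbell formula (`IsInversion.campbell`): M(dz) z(dx) is
the image of Q(dy) du under (y,u) ↦ (z,u). Stationarity of M, the Palm formula, σ-finiteness and the
conditional law of T are read off from it.

It remains to see that the construction realises M (`lintegral_changed`). Lebesgue measure is the
sum over lattice points s of uniform measures on unit cubes, so u can be written T - s with T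
uniform. The weight at T - s vanishes unless s belongs to the cell of 0, and otherwise it is the
inverse mass of the unit cube under θ_{-T}ξ°. The uniform choice of S contributes 1/|D°|, which the
factor |D°| in the density cancels. This needs a finite cell, which the convex hull condition
provides (`finite_originCell`), and an occupied origin, which follows from 0 being in the support.
-/

instance (μ : LFMeasure d) : IsLocallyFiniteMeasure (μ : Measure (Space d)) := μ.2

/-! ### The lattice and the unit cube -/

theorem toSpace_apply (i : Lattice d) (k : Fin d) : toSpace i k = (i k : ℝ) := rfl

theorem toSpace_add (i j : Lattice d) : toSpace (i + j) = toSpace i + toSpace j := by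
  ext k
  simp [toSpace]

theorem toSpace_neg (i : Lattice d) : toSpace (-i) = -toSpace i := by
  ext k
  simp [toSpace]

theorem toSpace_zero : toSpace (0 : Lattice d) = 0 := by
  ext k
  simp [toSpace]

theorem unitCube_eq_preimage : unitCube d =
    (MeasurableEquiv.toLp 2 (Fin d → ℝ)).symm ⁻¹' (Set.univ.pi fun _ => Set.Ico (0 : ℝ) 1) := by
  ext x
  simp [unitCube]

theorem measurableSet_unitCube : MeasurableSet (unitCube d) := by
  rw [unitCube_eq_preimage]
  exact (MeasurableEquiv.measurable _) (MeasurableSet.univ_pi fun _ => measurableSet_Ico)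

theorem volume_unitCube : volume (unitCube d) = 1 := by
  rw [unitCube_eq_preimage,
    (EuclideanSpace.volume_preserving_symm_measurableEquiv_toLp (Fin d)).measure_preimage
      (MeasurableSet.univ_pi fun _ => measurableSet_Ico).nullMeasurableSet, volume_pi_pi]
  simp

/-- The lattice point whose cube contains `x`. -/
def latticeFloor (x : Space d) : Lattice d := fun k => ⌊x k⌋

theorem sub_toSpace_mem_unitCube_iff (x : Space d) (i : Lattice d) :
    x - toSpace i ∈ unitCube d ↔ i = latticeFloor x := by
  simp only [unitCube, Set.mem_ofPred_eq, PiLp.sub_apply, toSpace_apply, funext_iff, latticeFloor]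
  refine forall_congr' fun k => ?_
  rw [eq_comm, Int.floor_eq_iff]
  constructor <;> rintro ⟨h1, h2⟩ <;> constructor <;> linarith

theorem measurable_toSpace : Measurable (toSpace : Lattice d → Space d) := measurable_of_countable _

theorem cond_unitCube_volume :
    ProbabilityTheory.cond (volume : Measure (Space d)) (unitCube d) = volume.restrict (unitCube d) := by
  simp [ProbabilityTheory.cond, volume_unitCube]

/-- Lebesgue measure unfolds over the translates of the unit cube. -/
theorem lintegral_eq_tsum_unitCube (φ : Space d → ℝ≥0∞) :
    ∫⁻ x, φ x = ∑' s : Lattice d, ∫⁻ u in unitCube d, φ (u - toSpace s) := by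
  have hm : ∀ s : Lattice d, MeasurableSet {x : Space d | x + toSpace s ∈ unitCube d} := fun s =>
    measurableSet_unitCube.preimage (measurable_id.add_const _)
  have hU : (⋃ s : Lattice d, {x : Space d | x + toSpace s ∈ unitCube d}) = Set.univ := by
    refine Set.eq_univ_of_forall fun x => Set.mem_iUnion.2 ⟨-latticeFloor x, ?_⟩
    have := (sub_toSpace_mem_unitCube_iff x _).2 rfl
    simpa [toSpace_neg, sub_eq_add_neg] using this
  have hd : Pairwise (Function.onFun Disjoint
      fun s : Lattice d => {x : Space d | x + toSpace s ∈ unitCube d}) := by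
    intro s t hst
    refine Set.disjoint_left.2 fun x hs ht => hst ?_
    have e : ∀ s : Lattice d, x + toSpace s ∈ unitCube d → -s = latticeFloor x := fun s hs => by
      rw [← sub_toSpace_mem_unitCube_iff, toSpace_neg, sub_neg_eq_add]
      exact hs
    exact neg_injective ((e s hs).trans (e t ht).symm)
  rw [← setLIntegral_univ, ← hU, lintegral_iUnion hm hd]
  refine tsum_congr fun s => ?_
  rw [← lintegral_indicator (hm s), ← lintegral_indicator measurableSet_unitCube,
    ← lintegral_sub_right_eq_self _ (toSpace s)]
  refine lintegral_congr fun u => ?_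
  by_cases h : u ∈ unitCube d <;> simp [Set.indicator, h]

/-! ### Integration against random measures -/

/-- The tautological kernel from locally finite measures to space. -/
def evalKernel (d : ℕ) : Kernel (LFMeasure d) (Space d) where
  toFun μ := μ
  measurable' := measurable_subtype_coe

theorem evalKernel_apply (μ : LFMeasure d) : evalKernel d μ = (μ : Measure (Space d)) := rfl

theorem measurable_mass {B : Set (Space d)} (hB : MeasurableSet B) :
    Measurable fun μ : LFMeasure d => (μ : Measure (Space d)) B :=
  (Measure.measurable_coe hB).comp measurable_subtype_coe

theorem mass_lt_top (μ : LFMeasure d) {B : Set (Space d)} (hB : Bornology.IsBounded B) :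
    (μ : Measure (Space d)) B < ∞ := hB.measure_lt_top

theorem isBounded_unitCube : Bornology.IsBounded (unitCube d) := by
  have h : IsCompact (Set.univ.pi fun _ : Fin d => Set.Icc (0 : ℝ) 1) :=
    isCompact_univ_pi fun _ => isCompact_Icc
  refine (h.image (PiLp.continuous_toLp 2 (fun _ : Fin d => ℝ))).isBounded.subset fun x hx => ?_
  exact ⟨x.ofLp, fun k _ => ⟨(hx k).1, (hx k).2.le⟩, rfl⟩

/-- The kernel `μ ↦ μ(· | B)`. -/
def condKernel {B : Set (Space d)} (hB : MeasurableSet B) : Kernel (LFMeasure d) (Space d) where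
  toFun μ := ProbabilityTheory.cond (μ : Measure (Space d)) B
  measurable' := by
    refine Measure.measurable_of_measurable_coe _ fun A hA => ?_
    simp only [cond_apply hB]
    exact (measurable_mass hB).inv.mul (measurable_mass (hB.inter hA))

theorem condKernel_apply {B : Set (Space d)} (hB : MeasurableSet B) (μ : LFMeasure d) :
    condKernel hB μ = ProbabilityTheory.cond (μ : Measure (Space d)) B := rfl

instance {B : Set (Space d)} (hB : MeasurableSet B) : IsFiniteKernel (condKernel hB) := by
  refine ⟨1, ENNReal.one_lt_top, fun μ => ?_⟩
  rw [condKernel_apply, cond_apply hB, Set.inter_univ]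
  exact ENNReal.inv_mul_le_one _

/-- The masses of B are finite but not bounded uniformly in μ, so the restriction need not be a
finite kernel. Writing it as a finite kernel with a finite density still gives s-finiteness, on
which measurability of parametrised integrals rests. -/
theorem restrict_evalKernel {B : Set (Space d)} (hB : MeasurableSet B)
    (hb : Bornology.IsBounded B) : (evalKernel d).restrict hB =
      (condKernel hB).withDensity fun μ _ => (μ : Measure (Space d)) B := by
  ext1 μ
  have hf : Measurable (Function.uncurry fun (μ : LFMeasure d) (_ : Space d) =>
    (μ : Measure (Space d)) B) := (measurable_mass hB).comp measurable_fst
  rw [Kernel.restrict_apply, Kernel.withDensity_apply _ hf,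
    withDensity_const, condKernel_apply, ProbabilityTheory.cond, smul_smul, evalKernel_apply]
  by_cases h : (μ : Measure (Space d)) B = 0
  · rw [Measure.restrict_eq_zero.2 h, smul_zero]
  · rw [ENNReal.mul_inv_cancel h (mass_lt_top μ hb).ne, one_smul]

theorem measurableSet_cube (s : Lattice d) :
    MeasurableSet {x : Space d | x - toSpace s ∈ unitCube d} :=
  measurableSet_unitCube.preimage (measurable_id.sub_const _)

theorem isBounded_cube (s : Lattice d) :
    Bornology.IsBounded {x : Space d | x - toSpace s ∈ unitCube d} := by
  refine (isBounded_unitCube.vadd (toSpace s)).subset fun x hx => ?_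
  exact ⟨x - toSpace s, hx, by simp⟩

theorem disjoint_cube : Pairwise (Function.onFun Disjoint
    fun s : Lattice d => {x : Space d | x - toSpace s ∈ unitCube d}) := by
  intro s t hst
  refine Set.disjoint_left.2 fun x hs ht => hst ?_
  exact ((sub_toSpace_mem_unitCube_iff x s).1 hs).trans
    ((sub_toSpace_mem_unitCube_iff x t).1 ht).symm

theorem iUnion_cube :
    (⋃ s : Lattice d, {x : Space d | x - toSpace s ∈ unitCube d}) = Set.univ :=
  Set.eq_univ_of_forall fun x => Set.mem_iUnion.2
    ⟨latticeFloor x, (sub_toSpace_mem_unitCube_iff x _).2 rfl⟩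

instance : IsSFiniteKernel (evalKernel d) := by
  have h : evalKernel d = Kernel.sum fun s : Lattice d =>
      (evalKernel d).restrict (measurableSet_cube s) := by
    ext1 μ
    rw [Kernel.sum_apply]
    simp only [Kernel.restrict_apply]
    rw [← Measure.restrict_iUnion disjoint_cube measurableSet_cube, iUnion_cube,
      Measure.restrict_univ]
  have hs : ∀ s : Lattice d, IsSFiniteKernel ((evalKernel d).restrict (measurableSet_cube s)) := by
    intro s
    rw [restrict_evalKernel _ (isBounded_cube s)]
    exact Kernel.IsSFiniteKernel.withDensity _ fun μ _ => (mass_lt_top μ (isBounded_cube s)).ne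
  rw [h]
  exact Kernel.isSFiniteKernel_sum

/-- Integrals against a random measure are measurable. -/
theorem measurable_lintegral_random {α : Type*} [MeasurableSpace α] {m : α → LFMeasure d}
    (hm : Measurable m) {f : α → Space d → ℝ≥0∞} (hf : Measurable (Function.uncurry f)) :
    Measurable fun a => ∫⁻ x, f a x ∂(m a : Measure (Space d)) :=
  Measurable.lintegral_kernel_prod_right (κ := (evalKernel d).comap m hm) hf

theorem lintegral_shift (t : Space d) (μ : LFMeasure d) (f : Space d → ℝ≥0∞) :
    ∫⁻ x, f x ∂((t +ᵥ μ : LFMeasure d) : Measure (Space d)) =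
      ∫⁻ x, f (x - t) ∂(μ : Measure (Space d)) := by
  rw [coe_shift]
  exact (Homeomorph.subRight t).measurableEmbedding.lintegral_map f

theorem shift_apply_preimage (t : Space d) (μ : LFMeasure d) (B : Set (Space d)) :
    ((t +ᵥ μ : LFMeasure d) : Measure (Space d)) B =
      (μ : Measure (Space d)) {x | x - t ∈ B} := by
  rw [coe_shift]
  exact (Homeomorph.subRight t).measurableEmbedding.map_apply _ _

instance : MeasurableVAdd₂ (Space d) (LFMeasure d) where
  measurable_vadd := by
    refine Measurable.subtype_mk (Measure.measurable_of_measurable_coe _ fun B hB => ?_)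
    have : ∀ p : Space d × LFMeasure d, ((p.2 : Measure (Space d)).map fun x => x - p.1) B =
        ∫⁻ x, B.indicator 1 (x - p.1) ∂(p.2 : Measure (Space d)) := by
      intro p
      rw [← coe_shift, ← lintegral_shift, lintegral_indicator_one hB]
    change Measurable fun p : Space d × LFMeasure d =>
      ((p.2 : Measure (Space d)).map fun x => x - p.1) B
    simp only [this]
    refine measurable_lintegral_random measurable_snd ?_
    exact (measurable_one.indicator hB).comp (measurable_snd.sub (measurable_fst.comp measurable_fst))

instance {E F : Type*} [MeasurableSpace E] [MeasurableSpace F] [VAdd (Space d) E]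
    [VAdd (Space d) F] [MeasurableVAdd₂ (Space d) E] [MeasurableVAdd₂ (Space d) F] :
    MeasurableVAdd₂ (Space d) (E × F) where
  measurable_vadd := (measurable_fst.vadd measurable_snd.fst).prodMk
    (measurable_fst.vadd measurable_snd.snd)

end

section

variable {d : ℕ}

/-! ### Centres of Voronoi cells -/

theorem mem_occupied_iff (μ : LFMeasure d) (i : Lattice d) :
    i ∈ occupied μ ↔ 0 < (μ : Measure (Space d)) {x | x - toSpace i ∈ unitCube d} := by
  have : (fun x => toSpace i + x) '' unitCube d = {x | x - toSpace i ∈ unitCube d} := by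
    ext x
    exact ⟨by rintro ⟨y, hy, rfl⟩; simpa using hy, fun h => ⟨x - toSpace i, h, by simp⟩⟩
  rw [occupied, Set.mem_ofPred_eq, this]

theorem mem_occupied_shift_iff (μ : LFMeasure d) (s i : Lattice d) :
    i ∈ occupied (toSpace s +ᵥ μ) ↔ i + s ∈ occupied μ := by
  rw [mem_occupied_iff, mem_occupied_iff, shift_apply_preimage]
  simp only [toSpace_add, Set.mem_ofPred_eq, sub_sub, add_comm]

theorem measurableSet_mem_occupied (i : Lattice d) :
    MeasurableSet {μ : LFMeasure d | i ∈ occupied μ} := by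
  simp only [mem_occupied_iff]
  exact measurableSet_lt measurable_const (measurable_mass (measurableSet_cube i))

theorem occupied_nonempty {μ : LFMeasure d} (h : (μ : Measure (Space d)) Set.univ ≠ 0) :
    (occupied μ).Nonempty := by
  by_contra hne
  rw [Set.not_nonempty_iff_eq_empty] at hne
  apply h
  rw [← iUnion_cube, measure_iUnion_null_iff]
  intro i
  by_contra hi
  have : i ∈ occupied μ := (mem_occupied_iff μ i).2 (pos_iff_ne_zero.2 hi)
  simp [hne] at this

theorem IsCentre.eq {N : Set (Lattice d)} {i n n' : Lattice d} (h : IsCentre N i n)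
    (h' : IsCentre N i n') : n = n' := by
  rcases h.2 n' h'.1 with h1 | ⟨h1, h2⟩ <;> rcases h'.2 n h.1 with h3 | ⟨h3, h4⟩
  · linarith
  · linarith
  · linarith
  · exact toLex.injective (le_antisymm h2 h4)

theorem finite_setOf_dist_toSpace_le (x : Space d) (r : ℝ) :
    {m : Lattice d | dist x (toSpace m) ≤ r}.Finite := by
  refine (Set.finite_Icc (fun k => ⌈x k - r⌉ : Lattice d) (fun k => ⌊x k + r⌋)).subset ?_
  intro m hm
  have h : ∀ k, |x k - m k| ≤ r := fun k => by
    have := PiLp.norm_apply_le (x - toSpace m) k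
    rw [← dist_eq_norm] at this
    exact this.trans hm
  constructor <;> intro k
  · exact Int.ceil_le.2 (by linarith [abs_le.1 (h k)])
  · exact Int.le_floor.2 (by linarith [abs_le.1 (h k)])

theorem exists_isCentre {N : Set (Lattice d)} (hN : N.Nonempty) (i : Lattice d) :
    ∃ n, IsCentre N i n := by
  obtain ⟨n₀, hn₀⟩ := hN
  set r := dist (toSpace i) (toSpace n₀)
  have hfin : (N ∩ {m | dist (toSpace i) (toSpace m) ≤ r}).Finite :=
    (finite_setOf_dist_toSpace_le _ r).inter_of_right _
  -- Minimising the pair (distance, position) lexicographically encodes the tie-breaking rule.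
  -- Points outside the ball of radius r lose to n₀ anyway.
  obtain ⟨n, hn, hmin⟩ := Set.exists_min_image _
    (fun m : Lattice d => toLex (dist (toSpace i) (toSpace m), toLex m)) hfin ⟨n₀, hn₀, by simp [r]⟩
  refine ⟨n, hn.1, fun m hm => ?_⟩
  by_cases h : dist (toSpace i) (toSpace m) ≤ r
  · exact Prod.Lex.le_iff.1 (hmin m ⟨hm, h⟩)
  · exact Or.inl (hn.2.trans_lt (not_le.1 h))

/-- Euclidean distance and the lexicographic order are both invariant under translation. -/
theorem isCentre_translate_iff {N N' : Set (Lattice d)} {s : Lattice d}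
    (h : ∀ i, i ∈ N' ↔ i + s ∈ N) (i n : Lattice d) :
    IsCentre N' i n ↔ IsCentre N (i + s) (n + s) := by
  have hd : ∀ a b : Lattice d, dist (toSpace (a + s)) (toSpace (b + s)) =
      dist (toSpace a) (toSpace b) := fun a b => by simp [toSpace_add]
  have hl : ∀ a b : Lattice d, toLex (a + s) ≤ toLex (b + s) ↔ toLex a ≤ toLex b :=
    fun a b => add_le_add_iff_right (toLex s)
  constructor
  · rintro ⟨h1, h2⟩
    refine ⟨(h n).1 h1, fun m hm => ?_⟩
    have := h2 (m - s) ((h _).2 (by simpa using hm))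
    rwa [← hd i, ← hd i, ← hl n, sub_add_cancel] at this
  · rintro ⟨h1, h2⟩
    refine ⟨(h n).2 h1, fun m hm => ?_⟩
    have := h2 (m + s) ((h m).1 hm)
    rwa [hd, hd, hl] at this

theorem measurableSet_isCentre (i n : Lattice d) :
    MeasurableSet {μ : LFMeasure d | IsCentre (occupied μ) i n} := by
  simp only [IsCentre]
  rw [measurableSet_setOfPred]
  refine (measurableSet_setOfPred.1 (measurableSet_mem_occupied n)).and ?_
  refine Measurable.forall fun m => Measurable.imp ?_ measurable_const
  exact measurableSet_setOfPred.1 (measurableSet_mem_occupied m)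

open Classical in
/-- The lattice point to which the origin is associated, and `0` if there is no such point. -/
def centre (μ : LFMeasure d) : Lattice d :=
  if h : ∃ n, IsCentre (occupied μ) 0 n then h.choose else 0

theorem centre_eq {μ : LFMeasure d} {n : Lattice d} (h : IsCentre (occupied μ) 0 n) :
    centre μ = n := by
  have h' : ∃ n, IsCentre (occupied μ) 0 n := ⟨n, h⟩
  rw [centre, dif_pos h']
  exact h'.choose_spec.eq h

theorem isCentre_centre {μ : LFMeasure d} (h : (μ : Measure (Space d)) Set.univ ≠ 0) :
    IsCentre (occupied μ) 0 (centre μ) := by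
  obtain ⟨n, hn⟩ := exists_isCentre (occupied_nonempty h) 0
  rwa [centre_eq hn]

theorem measurable_centre : Measurable (centre : LFMeasure d → Lattice d) := by
  refine measurable_to_countable' fun n => ?_
  -- The second set accounts for the default value 0 where no centre exists.
  have : centre ⁻¹' {n} = {μ : LFMeasure d | IsCentre (occupied μ) 0 n} ∪
      ({μ : LFMeasure d | ∃ k, IsCentre (occupied μ) 0 k}ᶜ ∩ {_μ | n = 0}) := by
    ext μ
    by_cases h : ∃ k, IsCentre (occupied μ) 0 k
    · obtain ⟨k, hk⟩ := h
      have h1 : IsCentre (occupied μ) 0 n ↔ k = n := ⟨hk.eq, fun h => h ▸ hk⟩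
      have h2 : ∃ k, IsCentre (occupied μ) 0 k := ⟨k, hk⟩
      simp [centre_eq hk, h1, h2]
    · have h1 : ¬ IsCentre (occupied μ) 0 n := fun h' => h ⟨n, h'⟩
      have h2 : centre μ = 0 := by rw [centre, dif_neg h]
      simp only [Set.mem_preimage, Set.mem_singleton_iff, h2, Set.mem_union, Set.mem_ofPred_eq, h1,
        false_or, Set.mem_inter_iff, Set.mem_compl_iff, h, not_false_eq_true, true_and, eq_comm]
  rw [this]
  refine (measurableSet_isCentre 0 n).union (MeasurableSet.inter ?_ (MeasurableSet.const _))
  rw [Set.ofPred_exists]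
  exact (MeasurableSet.iUnion fun k => measurableSet_isCentre 0 k).compl

/-- The density of the uniform distribution on the cube of the centre of the origin. -/
def weight (μ : LFMeasure d) (x : Space d) : ℝ≥0∞ :=
  {x | x - toSpace (centre μ) ∈ unitCube d}.indicator
    (fun _ => ((μ : Measure (Space d)) {x | x - toSpace (centre μ) ∈ unitCube d})⁻¹) x

theorem weight_def (μ : LFMeasure d) (x : Space d) : weight μ x =
    {x | x - toSpace (centre μ) ∈ unitCube d}.indicator
      (fun _ => ((μ : Measure (Space d)) {x | x - toSpace (centre μ) ∈ unitCube d})⁻¹) x := rfl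

theorem measurable_centre_mass :
    Measurable fun μ : LFMeasure d =>
      (μ : Measure (Space d)) {x | x - toSpace (centre μ) ∈ unitCube d} := by
  simp_rw [← shift_apply_preimage]
  exact (measurable_mass measurableSet_unitCube).comp
    ((measurable_toSpace.comp measurable_centre).vadd measurable_id)

theorem measurable_weight :
    Measurable fun p : LFMeasure d × Space d => weight p.1 p.2 := by
  have : (fun p : LFMeasure d × Space d => weight p.1 p.2) =
      {p : LFMeasure d × Space d | p.2 - toSpace (centre p.1) ∈ unitCube d}.indicator
        fun p => ((p.1 : Measure (Space d)) {x | x - toSpace (centre p.1) ∈ unitCube d})⁻¹ := by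
    funext p
    simp [weight, Set.indicator]
  rw [this]
  refine Measurable.indicator (measurable_centre_mass.comp measurable_fst).inv ?_
  exact measurableSet_unitCube.preimage
    (measurable_snd.sub (measurable_toSpace.comp (measurable_centre.comp measurable_fst)))

/-- The substitution u = x - centre moves the cube of the centre onto the unit cube, and the inverse
mass in the weight is the normalising constant. -/
theorem lintegral_weight_mul (μ : LFMeasure d) (g : Space d → ℝ≥0∞) (hg : Measurable g) :
    ∫⁻ x, weight μ x * g (x - toSpace (centre μ)) ∂(μ : Measure (Space d)) =
      ∫⁻ u, g u ∂ProbabilityTheory.cond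
        ((toSpace (centre μ) +ᵥ μ : LFMeasure d) : Measure (Space d)) (unitCube d) := by
  rw [ProbabilityTheory.cond, lintegral_smul_measure, ← lintegral_indicator measurableSet_unitCube,
    lintegral_shift, shift_apply_preimage, smul_eq_mul,
    ← lintegral_const_mul]
  swap
  · exact (hg.indicator measurableSet_unitCube).comp (measurable_id.sub_const _)
  refine lintegral_congr fun x => ?_
  by_cases h : x - toSpace (centre μ) ∈ unitCube d <;> simp [weight, h]

/-- The centre is an occupied point and its cube is bounded, so the mass being inverted is neither 0
nor infinite. -/
theorem lintegral_weight {μ : LFMeasure d} (h : (μ : Measure (Space d)) Set.univ ≠ 0) :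
    ∫⁻ x, weight μ x ∂(μ : Measure (Space d)) = 1 := by
  have h1 := lintegral_weight_mul μ (fun _ => 1) measurable_const
  simp only [mul_one] at h1
  rw [h1, lintegral_one, cond_apply measurableSet_unitCube, Set.inter_univ]
  refine ENNReal.inv_mul_cancel ?_ (mass_lt_top _ isBounded_unitCube).ne
  rw [shift_apply_preimage]
  exact ((mem_occupied_iff _ _).1 (isCentre_centre h).1).ne'

attribute [irreducible] weight centre

end

/-! ### Mass-stationarity as exchangeability -/

section

variable {d : ℕ} {E : Type*} [MeasurableSpace E] [AddAction (Space d) E]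
  [MeasurableVAdd₂ (Space d) E]

/-- The joint measure of a configuration seen from a Lebesgue-random location `u` and a further
location `x` sampled from the random measure is symmetric in `u` and `x`. -/
def IsExchangeable (Q : Measure (E × LFMeasure d)) : Prop :=
  ∀ k : E × LFMeasure d → Space d → Space d → ℝ≥0∞,
    Measurable (fun p : (E × LFMeasure d) × Space d × Space d => k p.1 p.2.1 p.2.2) →
    ∫⁻ y, ∫⁻ u : Space d, ∫⁻ x, k (-u +ᵥ y) u x ∂((-u +ᵥ y).2 : Measure (Space d)) ∂volume ∂Q =
      ∫⁻ y, ∫⁻ u : Space d, ∫⁻ x, k (-u +ᵥ y) x u ∂((-u +ᵥ y).2 : Measure (Space d)) ∂volume ∂Q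

/-- The substitution x = v + u turns sampling v from C - u into sampling x from C under the measure
shifted by -u, so both locations become points of the same set C. -/
theorem cond_shifted_lintegral {C : Set (Space d)} (hC : MeasurableSet C) (μ : LFMeasure d)
    (u : Space d) (h : Space d → ℝ≥0∞) :
    ∫⁻ v, h (v + u) ∂(ProbabilityTheory.cond (μ : Measure (Space d)) ((fun y => y - u) '' C)) =
      (((-u +ᵥ μ : LFMeasure d) : Measure (Space d)) C)⁻¹ *
        ∫⁻ x in C, h x ∂((-u +ᵥ μ : LFMeasure d) : Measure (Space d)) := by
  have e : (fun y => y - u) '' C = {x | x - -u ∈ C} := by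
    ext x
    exact ⟨by rintro ⟨y, hy, rfl⟩; simpa using hy, fun h => ⟨x + u, by simpa using h, by simp⟩⟩
  have hm : MeasurableSet {x | x - -u ∈ C} := hC.preimage (measurable_id.sub_const _)
  rw [e, ProbabilityTheory.cond, lintegral_smul_measure, shift_apply_preimage, smul_eq_mul,
    ← lintegral_indicator hm, ← lintegral_indicator hC, lintegral_shift]
  congr 1
  refine lintegral_congr fun x => ?_
  by_cases hx : x - -u ∈ C <;> simp [Set.indicator]

theorem measurable_kernel_slice {k : E × LFMeasure d → Space d → Space d → ℝ≥0∞}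
    (hk : Measurable fun p : (E × LFMeasure d) × Space d × Space d => k p.1 p.2.1 p.2.2) :
    Measurable fun p : (E × LFMeasure d) × Space d =>
      ∫⁻ x, k (-p.2 +ᵥ p.1) p.2 x ∂((-p.2 +ᵥ p.1).2 : Measure (Space d)) := by
  have hz : Measurable fun p : (E × LFMeasure d) × Space d => -p.2 +ᵥ p.1 :=
    measurable_snd.neg.vadd measurable_fst
  refine measurable_lintegral_random (measurable_snd.comp hz) ?_
  exact hk.comp ((hz.comp measurable_fst).prodMk
    ((measurable_snd.comp measurable_fst).prodMk measurable_snd))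

/-- Mass-stationarity with respect to `C` is exchangeability on `C`. -/
theorem exchange_on {Ω : Type*} [MeasurableSpace Ω] {P : Measure Ω} {Y : Ω → E × LFMeasure d}
    (hY : Measurable Y) (hms : IsMassStationary P Y) {C : Set (Space d)} (hC : MeasurableSet C)
    (hb : Bornology.IsBounded C) (hpos : 0 < volume C) (hfr : volume (frontier C) = 0)
    {k : E × LFMeasure d → Space d → Space d → ℝ≥0∞}
    (hk : Measurable fun p : (E × LFMeasure d) × Space d × Space d => k p.1 p.2.1 p.2.2) :
    ∫⁻ y, ∫⁻ u in C, ∫⁻ x in C, k (-u +ᵥ y) u x ∂((-u +ᵥ y).2 : Measure (Space d))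
        ∂volume ∂(P.map Y) =
      ∫⁻ y, ∫⁻ u in C, ∫⁻ x in C, k (-u +ᵥ y) x u ∂((-u +ᵥ y).2 : Measure (Space d))
        ∂volume ∂(P.map Y) := by
  -- the common value of both sides
  have key : ∀ k : E × LFMeasure d → Space d → Space d → ℝ≥0∞,
      Measurable (fun p : (E × LFMeasure d) × Space d × Space d => k p.1 p.2.1 p.2.2) →
      ∫⁻ y, ∫⁻ u in C, ∫⁻ x in C, k (-u +ᵥ y) u x ∂((-u +ᵥ y).2 : Measure (Space d))
        ∂volume ∂(P.map Y) =
      ∫⁻ ω, ∫⁻ u in C, (((-u +ᵥ Y ω).2 : Measure (Space d)) C)⁻¹ *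
        ∫⁻ v in C, ∫⁻ x in C, k (-u +ᵥ Y ω) v x ∂((-u +ᵥ Y ω).2 : Measure (Space d))
          ∂((-u +ᵥ Y ω).2 : Measure (Space d)) ∂volume ∂P := by
    intro k hk
    have hF : Measurable fun p : (E × LFMeasure d) × Space d =>
        ∫⁻ x in C, k (-p.2 +ᵥ p.1) p.2 x ∂((-p.2 +ᵥ p.1).2 : Measure (Space d)) := by
      simp_rw [← lintegral_indicator hC]
      have := measurable_kernel_slice (k := fun z u x => C.indicator (k z u) x)
        (by
          have : (fun p : (E × LFMeasure d) × Space d × Space d => C.indicator (k p.1 p.2.1) p.2.2) =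
            {p : (E × LFMeasure d) × Space d × Space d | p.2.2 ∈ C}.indicator
              fun p => k p.1 p.2.1 p.2.2 := by funext p; simp [Set.indicator]
          rw [this]
          exact hk.indicator (hC.preimage (measurable_snd.comp measurable_snd)))
      exact this
    -- The test function is (y,u) ↦ ∫_C k(θ_{-u}y, u, x), integrated in x against the measure of
    -- θ_{-u}y.
    have h := hms C hC hb hpos hfr _ hF
    have hc0 : volume C ≠ ∞ := hb.measure_lt_top.ne
    have hc : ProbabilityTheory.cond (volume : Measure (Space d)) C =
        (volume C)⁻¹ • volume.restrict C := rfl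
    have hc1 : (volume C)⁻¹ ≠ ∞ := ENNReal.inv_ne_top.2 hpos.ne'
    simp only [hc, lintegral_smul_measure, smul_eq_mul] at h
    rw [lintegral_const_mul' _ _ hc1, lintegral_const_mul' _ _ hc1,
      ENNReal.mul_right_inj (ENNReal.inv_ne_zero.2 hc0) hc1] at h
    rw [lintegral_map (Measurable.lintegral_prod_right' hF) hY, ← h]
    refine lintegral_congr fun ω => lintegral_congr fun u => ?_
    -- Moving the origin to v while replacing u by v + u leaves the configuration unchanged; only
    -- the location argument of k becomes v + u.
    have e : ∀ v : Space d, -(v + u) +ᵥ (v +ᵥ Y ω) = -u +ᵥ Y ω := fun v => by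
      rw [vadd_vadd]
      congr 1
      abel
    simp only [e]
    exact cond_shifted_lintegral hC (Y ω).2 u
      (fun v => ∫⁻ x in C, k (-u +ᵥ Y ω) v x ∂((-u +ᵥ Y ω).2 : Measure (Space d)))
  have hk' : Measurable fun p : (E × LFMeasure d) × Space d × Space d => k p.1 p.2.2 p.2.1 :=
    hk.comp (measurable_fst.prodMk
      ((measurable_snd.comp measurable_snd).prodMk (measurable_fst.comp measurable_snd)))
  -- In the common form v and x are both integrated over C against the same measure, so Tonelli
  -- gives the symmetry.
  rw [key k hk, key (fun z u x => k z x u) hk']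
  refine lintegral_congr fun ω => lintegral_congr fun u => ?_
  congr 1
  exact lintegral_lintegral_swap (hk.comp (measurable_const.prodMk measurable_id)).aemeasurable

/-- Monotone convergence for the threefold integrals in `IsExchangeable`. -/
theorem lintegral_iSup_slice {Q : Measure (E × LFMeasure d)}
    {k : ℕ → E × LFMeasure d → Space d → Space d → ℝ≥0∞}
    (hk : ∀ n, Measurable
      fun p : (E × LFMeasure d) × Space d × Space d => k n p.1 p.2.1 p.2.2)
    (hmono : ∀ z u x, Monotone fun n => k n z u x) :
    ∫⁻ y, ∫⁻ u : Space d, ∫⁻ x, ⨆ n, k n (-u +ᵥ y) u x ∂((-u +ᵥ y).2 : Measure (Space d))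
        ∂volume ∂Q =
      ⨆ n, ∫⁻ y, ∫⁻ u : Space d, ∫⁻ x, k n (-u +ᵥ y) u x ∂((-u +ᵥ y).2 : Measure (Space d))
        ∂volume ∂Q := by
  have h2 := fun n => measurable_kernel_slice (hk n)
  have h1 : ∀ n, Measurable fun y : E × LFMeasure d => ∫⁻ u : Space d,
      ∫⁻ x, k n (-u +ᵥ y) u x ∂((-u +ᵥ y).2 : Measure (Space d)) :=
    fun n => Measurable.lintegral_prod_right' (h2 n)
  rw [← lintegral_iSup h1
    (fun m n h y => lintegral_mono fun u => lintegral_mono fun x => hmono _ _ _ h)]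
  refine lintegral_congr fun y => ?_
  have h3 : ∀ n, Measurable fun u : Space d =>
      ∫⁻ x, k n (-u +ᵥ y) u x ∂((-u +ᵥ y).2 : Measure (Space d)) :=
    fun n => (h2 n).comp measurable_prodMk_left
  rw [← lintegral_iSup h3 (fun m n h u => lintegral_mono fun x => hmono _ _ _ h)]
  refine lintegral_congr fun u => lintegral_iSup (fun n => ?_) (fun m n h x => hmono _ _ _ h)
  generalize -u +ᵥ y = z
  exact (hk n).comp (measurable_prodMk_left.comp (measurable_prodMk_left (x := u)))

/-- Mass-stationarity implies exchangeability. -/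
theorem IsMassStationary.isExchangeable {Ω : Type*} [MeasurableSpace Ω] {P : Measure Ω}
    {Y : Ω → E × LFMeasure d} (hms : IsMassStationary P Y) (hY : Measurable Y) :
    IsExchangeable (P.map Y) := by
  -- exhaustion by balls
  let C : ℕ → Set (Space d) := fun n => Metric.ball 0 (n + 1)
  have hC : ∀ n, MeasurableSet (C n) := fun n => measurableSet_ball
  have hmono : Monotone C := fun m n h => Metric.ball_subset_ball (by gcongr)
  have hex : ∀ x y : Space d, ∃ n, x ∈ C n ∧ y ∈ C n := fun x y => by
    obtain ⟨n, hn⟩ := exists_nat_gt (max ‖x‖ ‖y‖)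
    have h1 := (le_max_left ‖x‖ ‖y‖).trans_lt hn
    have h2 := (le_max_right ‖x‖ ‖y‖).trans_lt hn
    exact ⟨n, by simp only [C, mem_ball_zero_iff]; linarith,
      by simp only [C, mem_ball_zero_iff]; linarith⟩
  have key : ∀ k : E × LFMeasure d → Space d → Space d → ℝ≥0∞,
      Measurable (fun p : (E × LFMeasure d) × Space d × Space d => k p.1 p.2.1 p.2.2) →
      ∫⁻ y, ∫⁻ u : Space d, ∫⁻ x, k (-u +ᵥ y) u x ∂((-u +ᵥ y).2 : Measure (Space d))
        ∂volume ∂(P.map Y) =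
      ⨆ n, ∫⁻ y, ∫⁻ u in C n, ∫⁻ x in C n, k (-u +ᵥ y) u x
        ∂((-u +ᵥ y).2 : Measure (Space d)) ∂volume ∂(P.map Y) := by
    intro k hk
    let kn : ℕ → E × LFMeasure d → Space d → Space d → ℝ≥0∞ := fun n z u x =>
      (C n ×ˢ C n).indicator (fun p => k z p.1 p.2) (u, x)
    have hkn : ∀ n, Measurable
        (fun p : (E × LFMeasure d) × Space d × Space d => kn n p.1 p.2.1 p.2.2) := by
      intro n
      have : (fun p : (E × LFMeasure d) × Space d × Space d => kn n p.1 p.2.1 p.2.2) =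
          {p : (E × LFMeasure d) × Space d × Space d | p.2 ∈ C n ×ˢ C n}.indicator
            fun p => k p.1 p.2.1 p.2.2 := by
        funext p
        simp [kn, Set.indicator]
      rw [this]
      exact hk.indicator (((hC n).prod (hC n)).preimage measurable_snd)
    have hknm : ∀ z u x, Monotone fun n => kn n z u x := fun z u x m n h =>
      Set.indicator_le_indicator_of_subset (Set.prod_mono (hmono h) (hmono h))
        (fun _ => zero_le) _
    have hsup : ∀ z u x, k z u x = ⨆ n, kn n z u x := by
      intro z u x
      refine le_antisymm ?_ (iSup_le fun n => Set.indicator_le_self' (fun _ _ => zero_le) _)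
      obtain ⟨n, h1, h2⟩ := hex u x
      refine le_iSup_of_le n (le_of_eq ?_)
      exact (Set.indicator_of_mem (Set.mk_mem_prod h1 h2) fun p : Space d × Space d =>
        k z p.1 p.2).symm
    have hrestr : ∀ n y, ∫⁻ u in C n, ∫⁻ x in C n, k (-u +ᵥ y) u x
        ∂((-u +ᵥ y).2 : Measure (Space d)) = ∫⁻ u : Space d, ∫⁻ x, kn n (-u +ᵥ y) u x
        ∂((-u +ᵥ y).2 : Measure (Space d)) := by
      intro n y
      rw [← lintegral_indicator (hC n)]
      refine lintegral_congr fun u => ?_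
      by_cases hu : u ∈ C n
      · rw [Set.indicator_of_mem hu, ← lintegral_indicator (hC n)]
        refine lintegral_congr fun x => ?_
        by_cases hx : x ∈ C n <;> simp [kn, hu, hx]
      · rw [Set.indicator_of_notMem hu]
        simp [kn, hu]
    simp only [hrestr]
    simp only [hsup]
    exact lintegral_iSup_slice hkn hknm
  intro k hk
  have hk' : Measurable fun p : (E × LFMeasure d) × Space d × Space d => k p.1 p.2.2 p.2.1 :=
    hk.comp (measurable_fst.prodMk
      ((measurable_snd.comp measurable_snd).prodMk (measurable_fst.comp measurable_snd)))
  rw [key k hk, key (fun z u x => k z x u) hk']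
  -- Balls are admissible sets: the radius n + 1 is positive even for n = 0, and convex sets have
  -- Lebesgue-null frontier.
  refine iSup_congr fun n => exchange_on hY hms (hC n) Metric.isBounded_ball
    (Metric.measure_ball_pos _ _ (by positivity)) ?_ hk
  exact (convex_ball _ _).addHaar_frontier _

end

/-! ### Inversion: Campbell formula, stationarity, Palm formula and σ-finiteness -/

section

variable {d : ℕ} {E : Type*} [MeasurableSpace E]

theorem measurable_lintegral_snd {g : E × LFMeasure d → Space d → ℝ≥0∞}
    (hg : Measurable (Function.uncurry g)) :
    Measurable fun z : E × LFMeasure d => ∫⁻ x, g z x ∂(z.2 : Measure (Space d)) :=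
  measurable_lintegral_random measurable_snd hg

theorem measurable_weight_snd :
    Measurable fun p : (E × LFMeasure d) × Space d => weight p.1.2 p.2 := by
  have h : Measurable fun p : (E × LFMeasure d) × Space d => (p.1.2, p.2) :=
    (measurable_snd.comp measurable_fst).prodMk measurable_snd
  exact measurable_weight.comp h

theorem snd_vadd {F : Type*} [AddAction (Space d) F] (t : Space d) (z : F × LFMeasure d) :
    (t +ᵥ z).2 = t +ᵥ z.2 := rfl

variable [AddAction (Space d) E]

/-- `M` is obtained from `Q` by moving the origin to a Lebesgue-random location, weighted by
`weight`. -/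
def IsInversion (Q M : Measure (E × LFMeasure d)) : Prop :=
  ∀ f : E × LFMeasure d → ℝ≥0∞, Measurable f →
    ∫⁻ z, f z ∂M =
      ∫⁻ y, ∫⁻ u : Space d, weight (-u +ᵥ y).2 u * f (-u +ᵥ y) ∂volume ∂Q

theorem shift_mass_univ (t : Space d) (μ : LFMeasure d) :
    ((t +ᵥ μ : LFMeasure d) : Measure (Space d)) Set.univ = (μ : Measure (Space d)) Set.univ := by
  rw [shift_apply_preimage]
  rfl

section Inversion

variable {Q M : Measure (E × LFMeasure d)}

/-- The refined Campbell theorem for the inverted measure. -/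
theorem IsInversion.campbell (hM : IsInversion Q M) (hex : IsExchangeable Q)
    (hQ : ∀ᵐ y ∂Q, (y.2 : Measure (Space d)) Set.univ ≠ 0)
    {g : E × LFMeasure d → Space d → ℝ≥0∞} (hg : Measurable (Function.uncurry g)) :
    ∫⁻ z, ∫⁻ x, g z x ∂(z.2 : Measure (Space d)) ∂M =
      ∫⁻ y, ∫⁻ u : Space d, g (-u +ᵥ y) u ∂volume ∂Q := by
  have hgz : ∀ z, Measurable (g z) := fun z => hg.comp measurable_prodMk_left
  have hwz : ∀ z : E × LFMeasure d, Measurable (weight z.2) :=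
    fun z => measurable_weight.comp measurable_prodMk_left
  rw [hM _ (measurable_lintegral_snd hg)]
  calc _ = ∫⁻ y, ∫⁻ u : Space d, ∫⁻ x, weight (-u +ᵥ y).2 u * g (-u +ᵥ y) x
        ∂((-u +ᵥ y).2 : Measure (Space d)) ∂volume ∂Q := by
        refine lintegral_congr fun y => lintegral_congr fun u => ?_
        rw [lintegral_const_mul _ (hgz _)]
    _ = ∫⁻ y, ∫⁻ u : Space d, ∫⁻ x, weight (-u +ᵥ y).2 x * g (-u +ᵥ y) u
        ∂((-u +ᵥ y).2 : Measure (Space d)) ∂volume ∂Q := by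
        -- Exchangeability moves the weight onto the sampled location x, where it can be integrated
        -- out.
        refine hex (fun z u x => weight z.2 u * g z x) (Measurable.mul ?_ ?_)
        · exact measurable_weight_snd.comp
            (measurable_fst.prodMk (measurable_fst.comp measurable_snd))
        · exact hg.comp (measurable_fst.prodMk (measurable_snd.comp measurable_snd))
    _ = _ := by
        refine lintegral_congr_ae (hQ.mono fun y hy => lintegral_congr fun u => ?_)
        rw [lintegral_mul_const _ (hwz _), lintegral_weight, one_mul]
        rwa [snd_vadd, shift_mass_univ]

/-- Under the inversion, the position of the Palm origin relative to the cube of its centre has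
the normalized restriction of the random measure to that cube as conditional distribution. -/
theorem IsInversion.lintegral_cond (hM : IsInversion Q M) (hex : IsExchangeable Q)
    (hQ : ∀ᵐ y ∂Q, (y.2 : Measure (Space d)) Set.univ ≠ 0)
    {g : E × LFMeasure d → Space d → ℝ≥0∞} (hg : Measurable (Function.uncurry g)) :
    ∫⁻ y, ∫⁻ u : Space d, weight (-u +ᵥ y).2 u *
        g (-u +ᵥ y) (u - toSpace (centre (-u +ᵥ y).2)) ∂volume ∂Q =
      ∫⁻ z, ∫⁻ v, g z v ∂ProbabilityTheory.cond
        ((toSpace (centre z.2) +ᵥ z.2 : LFMeasure d) : Measure (Space d)) (unitCube d) ∂M := by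
  have hm : Measurable fun p : (E × LFMeasure d) × Space d =>
      weight p.1.2 p.2 * g p.1 (p.2 - toSpace (centre p.1.2)) := by
    refine measurable_weight_snd.mul (hg.comp (measurable_fst.prodMk (measurable_snd.sub ?_)))
    exact measurable_toSpace.comp (measurable_centre.comp (measurable_snd.comp measurable_fst))
  rw [← hM.campbell hex hQ (g := fun z x => weight z.2 x * g z (x - toSpace (centre z.2))) hm]
  exact lintegral_congr fun z => lintegral_weight_mul z.2 (g z) (hg.comp measurable_prodMk_left)

variable [MeasurableVAdd₂ (Space d) E]

/-- Shifting by r only replaces the weight by weight(θ_{-r}z, x + r), which is again a probability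
density for the random measure of z. By the Campbell formula the inverted measure does not depend on
the choice of such a density. -/
theorem IsInversion.lintegral_vadd (hM : IsInversion Q M) (hex : IsExchangeable Q)
    (hQ : ∀ᵐ y ∂Q, (y.2 : Measure (Space d)) Set.univ ≠ 0)
    (hM0 : ∀ᵐ z ∂M, (z.2 : Measure (Space d)) Set.univ ≠ 0) (r : Space d)
    {f : E × LFMeasure d → ℝ≥0∞} (hf : Measurable f) :
    ∫⁻ z, f (r +ᵥ z) ∂M = ∫⁻ z, f z ∂M := by
  have hw : Measurable fun p : (E × LFMeasure d) × Space d =>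
      weight (-r +ᵥ p.1).2 (p.2 + r) :=
    measurable_weight_snd.comp ((measurable_fst.const_vadd (-r)).prodMk
      (measurable_snd.add_const r))
  calc ∫⁻ z, f (r +ᵥ z) ∂M
      = ∫⁻ y, ∫⁻ u : Space d, weight (-u +ᵥ y).2 u * f (r +ᵥ (-u +ᵥ y)) ∂volume ∂Q :=
        hM _ (hf.comp (measurable_const_vadd r))
    _ = ∫⁻ y, ∫⁻ u : Space d, f (-u +ᵥ y) * weight (-r +ᵥ (-u +ᵥ y)).2 (u + r)
          ∂volume ∂Q := by
        refine lintegral_congr fun y => ?_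
        rw [← lintegral_add_right_eq_self _ r]
        refine lintegral_congr fun u => ?_
        rw [mul_comm, vadd_vadd, vadd_vadd, ← sub_eq_add_neg, sub_add_cancel_right, neg_add_rev]
    _ = ∫⁻ z, ∫⁻ x, f z * weight (-r +ᵥ z).2 (x + r) ∂(z.2 : Measure (Space d)) ∂M :=
        (hM.campbell hex hQ (g := fun z x => f z * weight (-r +ᵥ z).2 (x + r))
          ((hf.comp measurable_fst).mul hw)).symm
    _ = ∫⁻ z, f z ∂M := by
        refine lintegral_congr_ae (hM0.mono fun z hz => ?_)
        have h : ∫⁻ x, weight (-r +ᵥ z).2 (x + r) ∂(z.2 : Measure (Space d)) = 1 := by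
          have h1 := lintegral_shift (-r) z.2 (weight (-r +ᵥ z).2)
          simp only [sub_neg_eq_add] at h1
          rw [← h1, ← snd_vadd]
          exact lintegral_weight (by rwa [snd_vadd, shift_mass_univ])
        have hm : Measurable fun x => weight (-r +ᵥ z).2 (x + r) :=
          hw.comp (measurable_prodMk_left (x := z))
        simp only
        rw [lintegral_const_mul _ hm, h, mul_one]

theorem measurable_indicator_vadd {f : E × LFMeasure d → ℝ≥0∞} (hf : Measurable f)
    {B : Set (Space d)} (hB : MeasurableSet B) :
    Measurable fun p : (E × LFMeasure d) × Space d =>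
      B.indicator (fun x => f (x +ᵥ p.1)) p.2 := by
  have : (fun p : (E × LFMeasure d) × Space d => B.indicator (fun x => f (x +ᵥ p.1)) p.2) =
      {p : (E × LFMeasure d) × Space d | p.2 ∈ B}.indicator fun p => f (p.2 +ᵥ p.1) := by
    funext p
    simp [Set.indicator]
  rw [this]
  exact (hf.comp (measurable_snd.vadd measurable_fst)).indicator (hB.preimage measurable_snd)

/-- Take g(z,x) = 1_B(x) f(θ_x z) in the Campbell formula. At x = u the two shifts cancel, so u
enters only through the indicator of B. -/
theorem IsInversion.lintegral_palm (hM : IsInversion Q M) (hex : IsExchangeable Q)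
    (hQ : ∀ᵐ y ∂Q, (y.2 : Measure (Space d)) Set.univ ≠ 0)
    {f : E × LFMeasure d → ℝ≥0∞} (hf : Measurable f) {B : Set (Space d)} (hB : MeasurableSet B) :
    ∫⁻ z, ∫⁻ x in B, f (x +ᵥ z) ∂(z.2 : Measure (Space d)) ∂M = (∫⁻ y, f y ∂Q) * volume B := by
  have hm := measurable_indicator_vadd hf hB
  simp only [← lintegral_indicator hB]
  rw [hM.campbell hex hQ (g := fun z x => B.indicator (fun x => f (x +ᵥ z)) x) hm,
    ← lintegral_mul_const _ hf]
  refine lintegral_congr fun y => ?_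
  rw [← setLIntegral_const, ← lintegral_indicator hB]
  refine lintegral_congr fun u => ?_
  by_cases hu : u ∈ B <;> simp [hu, vadd_vadd]

/-- A strictly positive Q-integrable f yields, through the Palm formula, functions h i of finite
M-integral. Every z with nonzero measure charges some cube, where the corresponding h i is positive,
so superlevel sets of the h i and one null set cover the space. -/
theorem IsInversion.sigmaFinite (hM : IsInversion Q M) (hex : IsExchangeable Q) [SigmaFinite Q]
    (hQ : ∀ᵐ y ∂Q, (y.2 : Measure (Space d)) Set.univ ≠ 0)
    (hM0 : ∀ᵐ z ∂M, (z.2 : Measure (Space d)) Set.univ ≠ 0) : SigmaFinite M := by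
  obtain ⟨f, hf0, hfm, hf⟩ := exists_pos_lintegral_lt_of_sigmaFinite Q one_ne_zero
  let cube : Lattice d → Set (Space d) := fun i => {x | x - toSpace i ∈ unitCube d}
  let h : Lattice d → E × LFMeasure d → ℝ≥0∞ := fun i z =>
    ∫⁻ x in cube i, f (x +ᵥ z) ∂(z.2 : Measure (Space d))
  have hvol : ∀ i, volume (cube i) ≠ ∞ := fun i => (isBounded_cube i).measure_lt_top.ne
  have hm : ∀ i, Measurable (h i) := by
    intro i
    simp only [h, ← lintegral_indicator (measurableSet_cube i), cube]
    exact measurable_lintegral_snd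
      (g := fun z x => {x | x - toSpace i ∈ unitCube d}.indicator
        (fun x => (f (x +ᵥ z) : ℝ≥0∞)) x)
      (measurable_indicator_vadd hfm.coe_nnreal_ennreal (measurableSet_cube i))
  have hfin : ∀ i, ∫⁻ z, h i z ∂M ≠ ∞ := by
    intro i
    rw [hM.lintegral_palm hex hQ hfm.coe_nnreal_ennreal (measurableSet_cube i)]
    exact ENNReal.mul_ne_top (hf.trans ENNReal.one_lt_top).ne (hvol i)
  -- The added 1 keeps the threshold finite at index 0, as Markov's inequality requires.
  let A : Lattice d × ℕ → Set (E × LFMeasure d) := fun q => {z | ((q.2 : ℝ≥0∞) + 1)⁻¹ ≤ h q.1 z}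
  let S : Set (Set (E × LFMeasure d)) :=
    insert {z | (z.2 : Measure (Space d)) Set.univ = 0} (Set.range A)
  refine Measure.sigmaFinite_of_countable (S := S) ((Set.countable_range A).insert _) ?_ ?_
  · rintro s (rfl | ⟨q, rfl⟩)
    · have : M {z | (z.2 : Measure (Space d)) Set.univ = 0} = 0 := by
        simpa [ae_iff] using hM0
      rw [this]
      exact ENNReal.zero_lt_top
    · refine (meas_ge_le_lintegral_div (hm q.1).aemeasurable ?_ ?_).trans_lt ?_
      · simp
      · simp
      · exact ENNReal.div_lt_top (hfin q.1) (by simp)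
  · refine Set.eq_univ_of_forall fun z => ?_
    by_cases hz : (z.2 : Measure (Space d)) Set.univ = 0
    · exact ⟨_, Set.mem_insert _ _, hz⟩
    obtain ⟨i, hi⟩ := occupied_nonempty hz
    rw [mem_occupied_iff] at hi
    have hpos : 0 < h i z := by
      refine (setLIntegral_pos_iff ?_).2 ?_
      · exact (hfm.comp (measurable_id.vadd measurable_const)).coe_nnreal_ennreal
      · refine hi.trans_le (measure_mono fun x hx => ⟨?_, hx⟩)
        simpa using (hf0 _).ne'
    obtain ⟨n, hn⟩ := ENNReal.exists_inv_nat_lt hpos.ne'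
    refine ⟨A (i, n), Set.mem_insert_of_mem _ ⟨_, rfl⟩, ?_⟩
    exact (ENNReal.inv_le_inv.2 le_self_add).trans hn.le

end Inversion

end

/-! ### Finiteness of the cell and occupation of the origin -/

section

variable {d : ℕ}

open Filter Topology in
/-- The Voronoi cell of an infinite set of lattice points recedes in some direction. -/
theorem exists_direction_of_infinite {N : Set (Lattice d)} {n₀ : Lattice d}
    (hinf : {i | IsCentre N i n₀}.Infinite) :
    ∃ e : Space d, ‖e‖ = 1 ∧ ∀ m ∈ N, inner ℝ e (toSpace m - toSpace n₀) ≤ 0 := by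
  have hex : ∀ k : ℕ, ∃ i, IsCentre N i n₀ ∧ (k : ℝ) < ‖toSpace i - toSpace n₀‖ := by
    intro k
    by_contra! hcon
    refine hinf ((finite_setOf_dist_toSpace_le (toSpace n₀) k).subset fun i hi => ?_)
    have := hcon i hi
    rwa [← dist_eq_norm, dist_comm] at this
  choose i hi hlarge using hex
  let x : ℕ → Space d := fun k => toSpace (i k) - toSpace n₀
  have hx0 : ∀ k, 0 < ‖x k‖ := fun k => (Nat.cast_nonneg k).trans_lt (hlarge k)
  have hsph : ∀ k, ‖x k‖⁻¹ • x k ∈ Metric.sphere (0 : Space d) 1 := fun k => by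
    rw [mem_sphere_zero_iff_norm, norm_smul, norm_inv, norm_norm, inv_mul_cancel₀ (hx0 k).ne']
  -- The direction e is a limit of directions from n₀ to cell points running off to infinity.
  obtain ⟨e, he, φ, hφ, hlim⟩ := (isCompact_sphere (0 : Space d) 1).tendsto_subseq hsph
  refine ⟨e, mem_sphere_zero_iff_norm.1 he, fun m hm => ?_⟩
  set v := toSpace m - toSpace n₀
  -- Being no farther from n₀ than from m means ‖x‖ ≤ ‖x - v‖, that is 2⟨x,v⟩ ≤ ‖v‖². After division
  -- by ‖x‖ the bound tends to 0.
  have hbound : ∀ k, inner ℝ (‖x k‖⁻¹ • x k) v ≤ ‖x k‖⁻¹ * (‖v‖ ^ 2 / 2) := by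
    intro k
    rw [real_inner_smul_left]
    refine mul_le_mul_of_nonneg_left ?_ (inv_nonneg.2 (norm_nonneg _))
    have h1 : dist (toSpace (i k)) (toSpace n₀) ≤ dist (toSpace (i k)) (toSpace m) := by
      rcases (hi k).2 m hm with h | h
      · exact h.le
      · exact h.1.le
    have h2 : ‖x k‖ ≤ ‖x k - v‖ := by
      simpa [x, v, dist_eq_norm] using h1
    have h3 := norm_sub_sq_real (x k) v
    have h4 : ‖x k‖ ^ 2 ≤ ‖x k - v‖ ^ 2 := by gcongr
    linarith
  have hinv : Tendsto (fun k => ‖x (φ k)‖⁻¹ * (‖v‖ ^ 2 / 2)) atTop (𝓝 0) := by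
    have h1 : Tendsto (fun k => ‖x k‖) atTop atTop :=
      tendsto_atTop_mono (fun k => (hlarge k).le) tendsto_natCast_atTop_atTop
    have h2 := (tendsto_inv_atTop_zero.comp h1).comp hφ.tendsto_atTop
    simpa using h2.mul_const (‖v‖ ^ 2 / 2)
  exact le_of_tendsto_of_tendsto' (hlim.inner tendsto_const_nhds) hinv fun k => hbound (φ k)

/-- Every point of the support is close to an occupied lattice point. -/
theorem exists_occupied_near {R : ℝ} (hR : ∀ x ∈ unitCube d, ‖x‖ ≤ R) (ξ : LFMeasure d)
    (t : Space d) {x : Space d} (hx : x ∈ (ξ : Measure (Space d)).support) :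
    ∃ m ∈ occupied (t +ᵥ ξ), ‖x - t - toSpace m‖ ≤ 1 + R := by
  have hpos : 0 < (ξ : Measure (Space d)) (Metric.ball x 1) :=
    (Measure.mem_support_iff_forall x).1 hx _ (Metric.ball_mem_nhds x one_pos)
  have hpos' : ((t +ᵥ ξ : LFMeasure d) : Measure (Space d)) (Metric.ball (x - t) 1) ≠ 0 := by
    rw [shift_apply_preimage]
    have : {y | y - t ∈ Metric.ball (x - t) 1} = Metric.ball x 1 := by
      ext y
      simp [Metric.mem_ball]
    rw [this]
    exact hpos.ne'
  rw [← Set.inter_univ (Metric.ball (x - t) 1), ← iUnion_cube, Set.inter_iUnion, ne_eq,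
    measure_iUnion_null_iff] at hpos'
  push Not at hpos'
  obtain ⟨m, hm⟩ := hpos'
  refine ⟨m, (mem_occupied_iff _ m).2 ((pos_iff_ne_zero.2 hm).trans_le
    (measure_mono Set.inter_subset_right)), ?_⟩
  obtain ⟨y, hy1, hy2⟩ := nonempty_of_measure_ne_zero hm
  have h1 : ‖y - (x - t)‖ < 1 := by rwa [← dist_eq_norm]
  have h2 : ‖y - toSpace m‖ ≤ R := hR _ hy2
  have h3 : x - t - toSpace m = -(y - (x - t)) + (y - toSpace m) := by abel
  rw [h3]
  refine (norm_add_le _ _).trans ?_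
  rw [norm_neg]
  linarith

/-- If the convex hull of the support is the whole space, then the cell of the origin is
finite. -/
theorem finite_originCell {ξ : LFMeasure d}
    (hconv : convexHull ℝ (ξ : Measure (Space d)).support = Set.univ) (t : Space d) :
    (originCell (occupied (t +ᵥ ξ))).Finite := by
  by_contra hinf
  obtain ⟨i₀, n₀, h₀, -⟩ := Set.Infinite.nonempty hinf
  have hsub : originCell (occupied (t +ᵥ ξ)) ⊆ {i | IsCentre (occupied (t +ᵥ ξ)) i n₀} := by
    rintro i ⟨n, hn, hi⟩
    rwa [hn.eq h₀] at hi
  obtain ⟨e, he, hle⟩ := exists_direction_of_infinite (Set.Infinite.mono hsub hinf)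
  obtain ⟨R, hR⟩ := (isBounded_unitCube (d := d)).exists_norm_le
  -- Here 1 + R bounds the distance to a nearby occupied lattice point, and the inner product undoes
  -- the shift by t and the recentring at n₀.
  set K : ℝ := 1 + R + inner ℝ e (t + toSpace n₀)
  have hK : ∀ x ∈ (ξ : Measure (Space d)).support, inner ℝ e x ≤ K := by
    intro x hx
    obtain ⟨m, hm, hnear⟩ := exists_occupied_near hR ξ t hx
    have h1 : inner ℝ e (x - t - toSpace m) ≤ 1 + R := by
      refine (real_inner_le_norm _ _).trans ?_
      rwa [he, one_mul]
    have h2 : x = (x - t - toSpace m) + (t + toSpace n₀) + (toSpace m - toSpace n₀) := by abel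
    rw [h2, inner_add_right, inner_add_right]
    linarith [hle m hm]
  have hhull : convexHull ℝ (ξ : Measure (Space d)).support ⊆ {x | inner ℝ e x ≤ K} :=
    convexHull_min hK (convex_halfSpace_le
      ⟨fun a b => inner_add_right e a b, fun c a => real_inner_smul_right e a c⟩ K)
  -- A support confined to a half-space cannot have full convex hull: (K + 1)e lies outside, as e is
  -- a unit vector.
  have hbad : inner ℝ e ((K + 1) • e) ≤ K := hhull (hconv ▸ Set.mem_univ _)
  rw [real_inner_smul_right, real_inner_self_eq_norm_sq, he] at hbad
  linarith

/-- The open unit cube. -/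
def openCube (d : ℕ) : Set (Space d) := {x | ∀ k, 0 < x k ∧ x k < 1}

theorem isOpen_openCube : IsOpen (openCube d) := by
  have : openCube d = ⋂ k, {x : Space d | 0 < x k ∧ x k < 1} := by
    ext x
    simp [openCube]
  rw [this]
  refine isOpen_iInter_of_finite fun k => ?_
  have hk : Continuous fun x : Space d => x k := by fun_prop
  exact (isOpen_lt continuous_const hk).inter (isOpen_lt hk continuous_const)

theorem volume_openCube : volume (openCube d) = 1 := by
  have : openCube d = (MeasurableEquiv.toLp 2 (Fin d → ℝ)).symm ⁻¹'
      (Set.univ.pi fun _ => Set.Ioo (0 : ℝ) 1) := by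
    ext x
    simp [openCube]
  rw [this, (EuclideanSpace.volume_preserving_symm_measurableEquiv_toLp (Fin d)).measure_preimage
      (MeasurableSet.univ_pi fun _ => measurableSet_Ioo).nullMeasurableSet, volume_pi_pi]
  simp

theorem openCube_subset : openCube d ⊆ unitCube d := fun _ hx k => ⟨(hx k).1.le, (hx k).2⟩

/-- If the origin is in the support and `t` is in the open unit cube, then the origin is
occupied after the shift by `-t`. -/
theorem zero_mem_occupied {ξ : LFMeasure d} (h0 : (0 : Space d) ∈ (ξ : Measure (Space d)).support)
    {t : Space d} (ht : t ∈ openCube d) : (0 : Lattice d) ∈ occupied (-t +ᵥ ξ) := by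
  rw [mem_occupied_iff, shift_apply_preimage]
  have hopen : IsOpen {x : Space d | x + t ∈ openCube d} :=
    isOpen_openCube.preimage (continuous_id.add continuous_const)
  refine ((Measure.mem_support_iff_forall _).1 h0 _ (hopen.mem_nhds (x := 0) ?_)).trans_le
    (measure_mono fun x hx => ?_)
  · simpa using ht
  · have := openCube_subset hx
    simpa [toSpace_zero] using this

theorem isCentre_zero {N : Set (Lattice d)} (h : (0 : Lattice d) ∈ N) : IsCentre N 0 0 := by
  refine ⟨h, fun m _ => ?_⟩
  rcases eq_or_ne m 0 with rfl | hm
  · exact Or.inr ⟨rfl, le_rfl⟩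
  · left
    rw [dist_self, dist_pos]
    intro heq
    refine hm (funext fun k => ?_)
    have := congrArg (fun v : Space d => v k) heq
    simpa [toSpace] using this.symm

/-- An occupied origin is its own centre, at distance 0. -/
theorem mem_originCell_iff {N : Set (Lattice d)} (h : (0 : Lattice d) ∈ N) (i : Lattice d) :
    i ∈ originCell N ↔ IsCentre N i 0 := by
  constructor
  · rintro ⟨n, hn, hi⟩
    rwa [hn.eq (isCentre_zero h)] at hi
  · exact fun hi => ⟨0, isCentre_zero h, hi⟩

end

section

/-! ### Conditional distributions -/

/-- Integration with respect to a countable variable of known conditional distribution. -/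
theorem HasCondDistrib.lintegral_countable {Ω 𝒴 𝒵 : Type*} [MeasurableSpace Ω] [MeasurableSpace 𝒴]
    [MeasurableSpace 𝒵] [Countable 𝒵] [MeasurableSingletonClass 𝒵] {P : Measure Ω} {Z : Ω → 𝒵}
    {Y : Ω → 𝒴} {κ : Ω → Measure 𝒵} (h : HasCondDistrib P Z Y κ) (hZ : Measurable Z)
    (hY : Measurable Y) (φ : 𝒴 → 𝒵 → ℝ≥0∞) (hφ : ∀ s, Measurable fun y => φ y s) :
    ∫⁻ ω, φ (Y ω) (Z ω) ∂P = ∑' s, ∫⁻ ω, κ ω {s} * φ (Y ω) s ∂P := by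
  obtain ⟨⟨K, hK⟩, h⟩ := h
  -- No measurability of κ is assumed; it comes from the almost everywhere agreement with a kernel
  -- evaluated at Y.
  have hκ : ∀ s, AEMeasurable (fun ω => κ ω {s}) P := fun s =>
    ⟨fun ω => K (Y ω) {s}, (K.measurable_coe (measurableSet_singleton s)).comp hY,
      hK.mono fun ω hω => by simp only [hω]⟩
  have hms : ∀ s, MeasurableSet (Z ⁻¹' {s}) := fun s => hZ (measurableSet_singleton s)
  have hun : (⋃ s, Z ⁻¹' {s}) = Set.univ := Set.eq_univ_of_forall fun ω =>
    Set.mem_iUnion.2 ⟨Z ω, rfl⟩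
  have hdis : Pairwise (Function.onFun Disjoint fun s => Z ⁻¹' {s}) := fun s t hst =>
    Disjoint.preimage _ (Set.disjoint_singleton.2 hst)
  rw [← setLIntegral_univ, ← hun, lintegral_iUnion hms hdis]
  refine tsum_congr fun s => ?_
  -- The defining identity with B = {s} says that restricting to Z = s and reweighting by κ{s} give
  -- Y the same law.
  have hmap : (P.restrict (Z ⁻¹' {s})).map Y = (P.withDensity fun ω => κ ω {s}).map Y := by
    ext A hA
    rw [Measure.map_apply hY hA, Measure.map_apply hY hA, Measure.restrict_apply (hY hA),
      withDensity_apply _ (hY hA)]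
    exact h A {s} hA (measurableSet_singleton s)
  calc ∫⁻ ω in Z ⁻¹' {s}, φ (Y ω) (Z ω) ∂P
      = ∫⁻ ω in Z ⁻¹' {s}, φ (Y ω) s ∂P :=
        setLIntegral_congr_fun (hms s) fun ω hω => by
          have : Z ω = s := hω
          simp only [this]
    _ = ∫⁻ y, φ y s ∂((P.restrict (Z ⁻¹' {s})).map Y) := (lintegral_map (hφ s) hY).symm
    _ = ∫⁻ ω, φ (Y ω) s ∂(P.withDensity fun ω => κ ω {s}) := by
        rw [hmap, lintegral_map (hφ s) hY]
    _ = ∫⁻ ω, κ ω {s} * φ (Y ω) s ∂P :=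
        lintegral_withDensity_eq_lintegral_mul₀ (hκ s) ((hφ s).comp hY).aemeasurable

/-- A constant conditional distribution means independence: the joint law agrees with the product on
rectangles, which suffices by σ-finiteness. -/
theorem HasCondDistrib.map_prod {Ω 𝒴 𝒵 : Type*} [MeasurableSpace Ω] [MeasurableSpace 𝒴]
    [MeasurableSpace 𝒵] {P : Measure Ω} {Z : Ω → 𝒵} {Y : Ω → 𝒴} {ν : Measure 𝒵} [SigmaFinite ν]
    (h : HasCondDistrib P Z Y fun _ => ν) (hZ : Measurable Z) (hY : Measurable Y)
    [SigmaFinite (P.map Y)] : P.map (fun ω => (Y ω, Z ω)) = (P.map Y).prod ν := by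
  refine (Measure.prod_eq fun A B hA hB => ?_).symm
  rw [Measure.map_apply (hY.prodMk hZ) (hA.prod hB), Measure.map_apply hY hA]
  refine (h.2 A B hA hB).trans ?_
  rw [setLIntegral_const, mul_comm]

theorem uniformOn_singleton_eq_zero {d : ℕ} {D : Set (Lattice d)} {s : Lattice d} (hs : s ∉ D) :
    uniformOn D {s} = 0 := by
  rw [uniformOn, cond_apply D.to_countable.measurableSet, Set.inter_singleton_eq_empty.2 hs,
    measure_empty, mul_zero]

/-- This is the cancellation between the law of S and the factor |D°| in the change of measure. -/
theorem uniformOn_singleton_mul_encard {d : ℕ} {D : Set (Lattice d)} (hD : D.Finite)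
    {s : Lattice d} (hs : s ∈ D) : uniformOn D {s} * (D.encard : ℝ≥0∞) = 1 := by
  have hm : MeasurableSet D := D.to_countable.measurableSet
  rw [uniformOn, cond_apply hm, Set.inter_eq_right.2 (Set.singleton_subset_iff.2 hs),
    Measure.count_singleton, mul_one, Measure.count_apply hm]
  refine ENNReal.inv_mul_cancel ?_ ?_
  · simpa [Set.encard_eq_zero] using Set.Nonempty.ne_empty ⟨s, hs⟩
  · simpa using hD

section CellMeasurability

variable {d : ℕ}

theorem measurableSet_mem_originCell (i : Lattice d) :
    MeasurableSet {μ : LFMeasure d | i ∈ originCell (occupied μ)} := by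
  have : {μ : LFMeasure d | i ∈ originCell (occupied μ)} =
      ⋃ n, {μ : LFMeasure d | IsCentre (occupied μ) 0 n} ∩
        {μ : LFMeasure d | IsCentre (occupied μ) i n} := by
    ext μ
    simp [originCell]
  rw [this]
  exact MeasurableSet.iUnion fun n => (measurableSet_isCentre 0 n).inter (measurableSet_isCentre i n)

theorem measurable_encard_originCell :
    Measurable fun μ : LFMeasure d => ((originCell (occupied μ)).encard : ℝ≥0∞) := by
  have : ∀ μ : LFMeasure d, ((originCell (occupied μ)).encard : ℝ≥0∞) =
      ∑' i, {μ : LFMeasure d | i ∈ originCell (occupied μ)}.indicator 1 μ := by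
    intro μ
    have hm : MeasurableSet (originCell (occupied μ)) := (Set.to_countable _).measurableSet
    rw [← Measure.count_apply hm, ← lintegral_indicator_one hm, lintegral_count]
    exact tsum_congr fun i => by simp [Set.indicator]
  simp only [this]
  exact Measurable.tsum fun i => measurable_one.indicator (measurableSet_mem_originCell i)

end CellMeasurability

/-! ### Unfolding the inversion over lattice shifts -/

section Unfolding

variable {d : ℕ}

theorem isCentre_shift_iff (μ : LFMeasure d) (s : Lattice d) :
    IsCentre (occupied (toSpace s +ᵥ μ)) 0 (-s) ↔ IsCentre (occupied μ) s 0 := by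
  rw [isCentre_translate_iff (mem_occupied_shift_iff μ s), zero_add, neg_add_cancel]

/-- The point u - s lies in the cube of -s and in no other, so the weight vanishes unless -s is the
centre of the shifted measure, that is, unless s has centre 0 before the shift. In that case the
cube of -s has the mass of the original unit cube. -/
theorem weight_shift {μ : LFMeasure d} (h : (μ : Measure (Space d)) Set.univ ≠ 0)
    (s : Lattice d) {u : Space d} (hu : u ∈ unitCube d) :
    weight (toSpace s +ᵥ μ) (u - toSpace s) =
      {μ : LFMeasure d | IsCentre (occupied μ) s 0}.indicator
        (fun μ => ((μ : Measure (Space d)) (unitCube d))⁻¹) μ := by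
  by_cases hs : IsCentre (occupied μ) s 0
  · have hc := centre_eq ((isCentre_shift_iff μ s).2 hs)
    have hmass : ((toSpace s +ᵥ μ : LFMeasure d) : Measure (Space d))
        {x | x - toSpace (-s) ∈ unitCube d} = (μ : Measure (Space d)) (unitCube d) := by
      rw [shift_apply_preimage]
      simp [toSpace_neg]
    have hmem : u - toSpace s ∈ {x : Space d | x - toSpace (-s) ∈ unitCube d} := by
      simpa [toSpace_neg] using hu
    rw [Set.indicator_of_mem (show μ ∈ {μ : LFMeasure d | IsCentre (occupied μ) s 0} from hs),
      weight_def, hc, Set.indicator_of_mem hmem, hmass]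
  · rw [Set.indicator_of_notMem (show μ ∉ {μ : LFMeasure d | IsCentre (occupied μ) s 0} from hs),
      weight_def, Set.indicator_of_notMem]
    intro hmem
    have h1 := (sub_toSpace_mem_unitCube_iff _ _).1 hmem
    have h2 : u - toSpace s - toSpace (-s) ∈ unitCube d := by simpa [toSpace_neg] using hu
    have h3 := h1.trans ((sub_toSpace_mem_unitCube_iff _ _).1 h2).symm
    have h4 := isCentre_centre (μ := toSpace s +ᵥ μ) (by rwa [shift_mass_univ])
    rw [h3] at h4
    exact hs ((isCentre_shift_iff μ s).1 h4)

theorem centre_shift {μ : LFMeasure d} {s : Lattice d} (hs : IsCentre (occupied μ) s 0) :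
    centre (toSpace s +ᵥ μ) = -s :=
  centre_eq ((isCentre_shift_iff μ s).2 hs)

variable {E : Type*} [AddAction (Space d) E]

/-- The contribution of the lattice shift by `s` to the changed measure, seen from the shift of
`y` by `-u`. -/
def shiftTerm (g : E × LFMeasure d → Space d → ℝ≥0∞) (s : Lattice d)
    (p : (E × LFMeasure d) × Space d) : ℝ≥0∞ :=
  {μ : LFMeasure d | IsCentre (occupied μ) s 0}.indicator
    (fun μ => ((μ : Measure (Space d)) (unitCube d))⁻¹) (-p.2 +ᵥ p.1.2) *
      g (toSpace s +ᵥ (-p.2 +ᵥ p.1)) p.2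

/-- The points u - s, with u in the unit cube and s in the lattice, exhaust the space. Where the
term is nonzero the centre is -s, so the position relative to it is (u - s) + s = u. -/
theorem tsum_shiftTerm {g : E × LFMeasure d → Space d → ℝ≥0∞} {y : E × LFMeasure d}
    (hy : (y.2 : Measure (Space d)) Set.univ ≠ 0) :
    ∑' s, ∫⁻ u in unitCube d, shiftTerm g s (y, u) =
      ∫⁻ u : Space d, weight (-u +ᵥ y).2 u *
        g (-u +ᵥ y) (u - toSpace (centre (-u +ᵥ y).2)) := by
  rw [lintegral_eq_tsum_unitCube]
  refine tsum_congr fun s => setLIntegral_congr_fun measurableSet_unitCube fun u hu => ?_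
  have hz : -(u - toSpace s) +ᵥ y = toSpace s +ᵥ (-u +ᵥ y) := by
    rw [vadd_vadd]
    congr 1
    abel
  have hmass : ((-u +ᵥ y.2 : LFMeasure d) : Measure (Space d)) Set.univ ≠ 0 := by
    rwa [shift_mass_univ]
  simp only [hz, snd_vadd, shiftTerm]
  rw [weight_shift hmass s hu]
  by_cases hs : IsCentre (occupied (-u +ᵥ y.2)) s 0
  · rw [centre_shift hs, toSpace_neg]
    simp
  · simp [hs]

variable [MeasurableSpace E] [MeasurableVAdd₂ (Space d) E]

theorem measurable_shiftTerm {g : E × LFMeasure d → Space d → ℝ≥0∞}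
    (hg : Measurable (Function.uncurry g)) (s : Lattice d) : Measurable (shiftTerm g s) := by
  have hz : Measurable fun p : (E × LFMeasure d) × Space d => -p.2 +ᵥ p.1 :=
    measurable_snd.neg.vadd measurable_fst
  have hz2 : Measurable fun p : (E × LFMeasure d) × Space d => -p.2 +ᵥ p.1.2 :=
    measurable_snd.neg.vadd (measurable_snd.comp measurable_fst)
  refine Measurable.mul ?_ (hg.comp ((hz.const_vadd (toSpace s)).prodMk measurable_snd))
  exact ((measurable_mass measurableSet_unitCube).inv.indicator (measurableSet_isCentre s 0)).comp
    hz2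

end Unfolding

end

/-! ### The joint law of the changed pair and T -/

section ChangeOfOrigin

variable {d : ℕ} {Ω E : Type*} [MeasurableSpace Ω] [MeasurableSpace E]
  {P₀ : Measure Ω} {Y₀ : Ω → E × LFMeasure d} {T : Ω → Space d}
  {S : Ω → Lattice d}

/-- The cell of the origin after a shift by `-t`. -/
def shiftedCell (p : (E × LFMeasure d) × Space d) : Set (Lattice d) :=
  originCell (occupied (-p.2 +ᵥ p.1.2))

/-- The density of the changed measure. -/
def cellDensity (p : (E × LFMeasure d) × Space d) : ℝ≥0∞ :=
  ((shiftedCell p).encard : ℝ≥0∞) / ((-p.2 +ᵥ p.1.2 : LFMeasure d) : Measure (Space d)) (unitCube d)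

theorem measurable_shift_snd :
    Measurable fun p : (E × LFMeasure d) × Space d => -p.2 +ᵥ p.1.2 :=
  measurable_snd.neg.vadd (measurable_snd.comp measurable_fst)

theorem measurable_cellDensity :
    Measurable (cellDensity : (E × LFMeasure d) × Space d → ℝ≥0∞) :=
  (measurable_encard_originCell.comp measurable_shift_snd).div
    ((measurable_mass measurableSet_unitCube).comp measurable_shift_snd)

theorem measurableSet_mem_shiftedCell (s : Lattice d) :
    MeasurableSet {p : (E × LFMeasure d) × Space d | s ∈ shiftedCell p} :=
  (measurableSet_mem_originCell s).preimage measurable_shift_snd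

/-- The uniform variable lies almost surely in the interior of the cube, so that the origin is
almost surely occupied. -/
theorem ae_zero_mem_occupied (hTlaw : HasCondDistrib P₀ T Y₀
      (fun _ => ProbabilityTheory.cond (volume : Measure (Space d)) (unitCube d)))
    (hsupp : ∀ᵐ ω ∂P₀, (0 : Space d) ∈ ((Y₀ ω).2 : Measure (Space d)).support) :
    ∀ᵐ ω ∂P₀, (0 : Lattice d) ∈ occupied (-T ω +ᵥ (Y₀ ω).2) := by
  have hnull : P₀ (T ⁻¹' (openCube d)ᶜ) = 0 := by
    have h := hTlaw.2 Set.univ (openCube d)ᶜ MeasurableSet.univ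
      isOpen_openCube.measurableSet.compl
    have h0 : volume.restrict (unitCube d) (openCube d)ᶜ = 0 := by
      rw [Measure.restrict_apply isOpen_openCube.measurableSet.compl, Set.inter_comm,
        ← Set.sdiff_eq, measure_sdiff openCube_subset
          isOpen_openCube.measurableSet.nullMeasurableSet (by simp [volume_openCube]),
        volume_unitCube, volume_openCube, tsub_self]
    simpa only [cond_unitCube_volume, h0, lintegral_zero, Set.preimage_univ, Set.univ_inter] using h
  have hT : ∀ᵐ ω ∂P₀, T ω ∈ openCube d := by
    rw [ae_iff]
    exact hnull
  filter_upwards [hsupp, hT] with ω h1 h2 using zero_mem_occupied h1 h2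

/-- As S takes countably many values, each s can be treated alone: where s is outside the cell, its
conditional probability is 0. This later locates the centre of ξ at -S. -/
theorem ae_mem_cell (hY₀ : Measurable Y₀) (hT : Measurable T)
    (hSlaw : HasCondDistrib P₀ S (fun ω => (Y₀ ω, T ω))
      (fun ω => uniformOn (shiftedCell (Y₀ ω, T ω)))) :
    ∀ᵐ ω ∂P₀, S ω ∈ shiftedCell (Y₀ ω, T ω) := by
  have key : ∀ s : Lattice d, ∀ᵐ ω ∂P₀, S ω = s → s ∈ shiftedCell (Y₀ ω, T ω) := by
    intro s
    have hA := (measurableSet_mem_shiftedCell (E := E) s).compl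
    have h := hSlaw.2 _ {s} hA (measurableSet_singleton s)
    have h0 : ∫⁻ ω in (fun ω => (Y₀ ω, T ω)) ⁻¹' {p | s ∈ shiftedCell p}ᶜ,
        uniformOn (shiftedCell (Y₀ ω, T ω)) {s} ∂P₀ = 0 := by
      rw [setLIntegral_congr_fun ((hY₀.prodMk hT) hA) (g := fun _ => 0), lintegral_zero]
      exact fun ω hω => uniformOn_singleton_eq_zero hω
    rw [h0] at h
    rw [ae_iff]
    refine measure_mono_null (fun ω hω => ?_) h
    rw [Set.mem_ofPred_eq, Classical.not_imp] at hω
    exact ⟨hω.2, hω.1⟩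
  filter_upwards [ae_all_iff.2 key] with ω hω using hω _ rfl

variable [AddAction (Space d) E] [MeasurableVAdd₂ (Space d) E]

theorem measurable_changeOfOrigin (hY₀ : Measurable Y₀) (hT : Measurable T) (hS : Measurable S) :
    Measurable fun ω => toSpace (S ω) +ᵥ (-T ω +ᵥ Y₀ ω) :=
  (measurable_toSpace.comp hS).vadd (hT.neg.vadd hY₀)

/-- The joint law of the changed pair and of `T` under the changed measure. -/
theorem lintegral_changed [SigmaFinite (P₀.map Y₀)] (hY₀ : Measurable Y₀) (hT : Measurable T)
    (hS : Measurable S)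
    (hTlaw : HasCondDistrib P₀ T Y₀
      (fun _ => ProbabilityTheory.cond (volume : Measure (Space d)) (unitCube d)))
    (hSlaw : HasCondDistrib P₀ S (fun ω => (Y₀ ω, T ω))
      (fun ω => uniformOn (shiftedCell (Y₀ ω, T ω))))
    (hfin : ∀ᵐ ω ∂P₀, (shiftedCell (Y₀ ω, T ω)).Finite)
    (hocc : ∀ᵐ ω ∂P₀, (0 : Lattice d) ∈ occupied (-T ω +ᵥ (Y₀ ω).2))
    (hQ : ∀ᵐ y ∂(P₀.map Y₀), (y.2 : Measure (Space d)) Set.univ ≠ 0)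
    {g : E × LFMeasure d → Space d → ℝ≥0∞} (hg : Measurable (Function.uncurry g)) :
    ∫⁻ ω, g (toSpace (S ω) +ᵥ (-T ω +ᵥ Y₀ ω)) (T ω)
        ∂(P₀.withDensity fun ω => cellDensity (Y₀ ω, T ω)) =
      ∫⁻ y, ∫⁻ u : Space d, weight (-u +ᵥ y).2 u *
        g (-u +ᵥ y) (u - toSpace (centre (-u +ᵥ y).2)) ∂volume ∂(P₀.map Y₀) := by
  have hYT : Measurable fun ω => (Y₀ ω, T ω) := hY₀.prodMk hT
  have hgm : Measurable fun ω => g (toSpace (S ω) +ᵥ (-T ω +ᵥ Y₀ ω)) (T ω) :=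
    hg.comp ((measurable_changeOfOrigin hY₀ hT hS).prodMk hT)
  let φ : (E × LFMeasure d) × Space d → Lattice d → ℝ≥0∞ := fun p s =>
    cellDensity p * g (toSpace s +ᵥ (-p.2 +ᵥ p.1)) p.2
  have hφ : ∀ s, Measurable fun p => φ p s := fun s =>
    measurable_cellDensity.mul (hg.comp
      (((measurable_snd.neg.vadd measurable_fst).const_vadd (toSpace s)).prodMk measurable_snd))
  calc _ = ∫⁻ ω, φ (Y₀ ω, T ω) (S ω) ∂P₀ :=
        lintegral_withDensity_eq_lintegral_mul _ (measurable_cellDensity.comp hYT) hgm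
    _ = ∑' s, ∫⁻ ω, uniformOn (shiftedCell (Y₀ ω, T ω)) {s} * φ (Y₀ ω, T ω) s ∂P₀ :=
        hSlaw.lintegral_countable hS hYT φ hφ
    _ = ∑' s, ∫⁻ ω, shiftTerm g s (Y₀ ω, T ω) ∂P₀ := by
        refine tsum_congr fun s => lintegral_congr_ae ?_
        -- Finiteness permits the cancellation of the cell size; occupation of the origin turns
        -- membership in the cell into having centre 0.
        filter_upwards [hfin, hocc] with ω h1 h2
        have hiff : s ∈ shiftedCell (Y₀ ω, T ω) ↔ IsCentre (occupied (-T ω +ᵥ (Y₀ ω).2)) s 0 :=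
          mem_originCell_iff h2 s
        by_cases hs : s ∈ shiftedCell (Y₀ ω, T ω)
        · have h3 := uniformOn_singleton_mul_encard h1 hs
          simp only [φ, cellDensity, shiftTerm]
          rw [Set.indicator_of_mem (show _ ∈ {μ : LFMeasure d | IsCentre (occupied μ) s 0} from
            hiff.1 hs), div_eq_mul_inv, ← mul_assoc, ← mul_assoc, h3, one_mul]
        · simp only [shiftTerm]
          rw [Set.indicator_of_notMem (show _ ∉ {μ : LFMeasure d | IsCentre (occupied μ) s 0} from
            fun h => hs (hiff.2 h)), uniformOn_singleton_eq_zero hs, zero_mul, zero_mul]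
    _ = ∑' s, ∫⁻ y, ∫⁻ u in unitCube d, shiftTerm g s (y, u) ∂volume ∂(P₀.map Y₀) := by
        refine tsum_congr fun s => ?_
        -- The cube has volume 1, so T has the restricted Lebesgue measure as its law and is
        -- independent of the pair.
        rw [cond_unitCube_volume] at hTlaw
        rw [← lintegral_map (measurable_shiftTerm hg s) hYT, hTlaw.map_prod hT hY₀,
          lintegral_prod _ (measurable_shiftTerm hg s).aemeasurable]
    _ = ∫⁻ y, ∑' s, ∫⁻ u in unitCube d, shiftTerm g s (y, u) ∂volume ∂(P₀.map Y₀) :=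
        (lintegral_tsum fun s =>
          (Measurable.lintegral_prod_right' (measurable_shiftTerm hg s)).aemeasurable).symm
    _ = _ := lintegral_congr_ae (hQ.mono fun y hy => tsum_shiftTerm hy)

end ChangeOfOrigin

end MassStat

end

/-! ### The theorem -/

theorem theorem3 {d : ℕ} {Ω E : Type*} [MeasurableSpace Ω] [MeasurableSpace E]
    [AddAction (MassStat.Space d) E] [MeasurableVAdd₂ (MassStat.Space d) E]
    (P₀ : Measure Ω)
    -- the pair `(X°, ξ°)`
    (X₀ : Ω → E) (hX₀ : Measurable X₀)
    (ξ₀ : Ω → MassStat.LFMeasure d) (hξ₀ : Measurable ξ₀)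
    (hσ : SigmaFinite (P₀.map (fun ω => (X₀ ω, ξ₀ ω))))
    (hsupp : ∀ᵐ ω ∂P₀, (0 : MassStat.Space d) ∈ (ξ₀ ω : Measure (MassStat.Space d)).support)
    (hconv : ∀ᵐ ω ∂P₀,
      convexHull ℝ (ξ₀ ω : Measure (MassStat.Space d)).support = Set.univ)
    (hms : MassStat.IsMassStationary P₀ (fun ω => (X₀ ω, ξ₀ ω)))
    -- `T` given `(X°, ξ°)` is uniform on the unit cube
    (T : Ω → MassStat.Space d) (hT : Measurable T)
    (hTlaw : MassStat.HasCondDistrib P₀ T (fun ω => (X₀ ω, ξ₀ ω))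
      (fun _ => cond (volume : Measure (MassStat.Space d)) (MassStat.unitCube d)))
    -- the Voronoi cell `D°`
    (D₀ : Ω → Set (MassStat.Lattice d))
    (hD₀ : ∀ ω, D₀ ω = MassStat.originCell (MassStat.occupied (-T ω +ᵥ ξ₀ ω)))
    -- `S` given `((X°, ξ°), T)` is uniform on `D°`
    (S : Ω → MassStat.Lattice d) (hS : Measurable S)
    (hSlaw : MassStat.HasCondDistrib P₀ S (fun ω => ((X₀ ω, ξ₀ ω), T ω))
      (fun ω => uniformOn (D₀ ω)))
    -- change of origin
    (X : Ω → E) (hX : ∀ ω, X ω = MassStat.toSpace (S ω) +ᵥ (-T ω +ᵥ X₀ ω))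
    (ξ : Ω → MassStat.LFMeasure d)
    (hξ : ∀ ω, ξ ω = MassStat.toSpace (S ω) +ᵥ (-T ω +ᵥ ξ₀ ω))
    -- change of measure
    (P : Measure Ω)
    (hP : P = P₀.withDensity (fun ω => ((D₀ ω).encard : ℝ≥0∞) /
      ((-T ω +ᵥ ξ₀ ω : MassStat.LFMeasure d) : Measure (MassStat.Space d))
        (MassStat.unitCube d))) :
    SigmaFinite (P.map (fun ω => (X ω, ξ ω))) ∧
    MassStat.IsStationary P (fun ω => (X ω, ξ ω)) ∧
    MassStat.HasCondDistrib P T (fun ω => (X ω, ξ ω))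
      (fun ω => cond
        ((-MassStat.toSpace (S ω) +ᵥ ξ ω : MassStat.LFMeasure d) : Measure (MassStat.Space d))
        (MassStat.unitCube d)) ∧
    MassStat.IsPalmVersion P₀ (fun ω => (X₀ ω, ξ₀ ω)) P (fun ω => (X ω, ξ ω)) := by
  set Y₀ : Ω → E × MassStat.LFMeasure d := fun ω => (X₀ ω, ξ₀ ω)
  have hY₀ : Measurable Y₀ := hX₀.prodMk hξ₀
  have hYeq : (fun ω => (X ω, ξ ω)) =
      fun ω => MassStat.toSpace (S ω) +ᵥ (-T ω +ᵥ Y₀ ω) := by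
    funext ω
    rw [hX, hξ]
    rfl
  have hPeq : P = P₀.withDensity fun ω => MassStat.cellDensity (Y₀ ω, T ω) := by
    rw [hP]
    congr 1
    funext ω
    rw [hD₀]
    rfl
  have hSlaw' : MassStat.HasCondDistrib P₀ S (fun ω => (Y₀ ω, T ω))
      (fun ω => uniformOn (MassStat.shiftedCell (Y₀ ω, T ω))) := by
    have : (fun ω => uniformOn (D₀ ω)) =
        fun ω => uniformOn (MassStat.shiftedCell (Y₀ ω, T ω)) := by
      funext ω
      rw [hD₀]
      rfl
    rwa [this] at hSlaw
  have hfin : ∀ᵐ ω ∂P₀, (MassStat.shiftedCell (Y₀ ω, T ω)).Finite :=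
    hconv.mono fun ω hω => MassStat.finite_originCell hω _
  have hocc := MassStat.ae_zero_mem_occupied (Y₀ := Y₀) hTlaw hsupp
  have hcell := MassStat.ae_mem_cell hY₀ hT hSlaw'
  have hac : P ≪ P₀ := hPeq ▸ withDensity_absolutelyContinuous _ _
  have hY : Measurable fun ω => (X ω, ξ ω) := by
    rw [hYeq]
    exact MassStat.measurable_changeOfOrigin hY₀ hT hS
  have hms0 : MeasurableSet {y : E × MassStat.LFMeasure d |
      (y.2 : Measure (MassStat.Space d)) Set.univ ≠ 0} :=
    ((MassStat.measurable_mass MeasurableSet.univ).comp measurable_snd)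
      (measurableSet_singleton (0 : ℝ≥0∞)).compl
  have hξ₀0 : ∀ᵐ ω ∂P₀, (ξ₀ ω : Measure (MassStat.Space d)) Set.univ ≠ 0 :=
    hsupp.mono fun ω hω =>
      ((Measure.mem_support_iff_forall _).1 hω Set.univ Filter.univ_mem).ne'
  have hQ : ∀ᵐ y ∂(P₀.map Y₀), (y.2 : Measure (MassStat.Space d)) Set.univ ≠ 0 :=
    (ae_map_iff hY₀.aemeasurable hms0).2 hξ₀0
  have hM0 : ∀ᵐ z ∂(P.map fun ω => (X ω, ξ ω)),
      (z.2 : Measure (MassStat.Space d)) Set.univ ≠ 0 := by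
    refine (ae_map_iff hY.aemeasurable hms0).2 ?_
    filter_upwards [hac.ae_le hξ₀0] with ω hω
    rwa [hξ, MassStat.shift_mass_univ, MassStat.shift_mass_univ]
  have hex : MassStat.IsExchangeable (P₀.map Y₀) := hms.isExchangeable hY₀
  have hjoint : ∀ g : E × MassStat.LFMeasure d → MassStat.Space d → ℝ≥0∞,
      Measurable (Function.uncurry g) → ∫⁻ ω, g (X ω, ξ ω) (T ω) ∂P =
        ∫⁻ y, ∫⁻ u : MassStat.Space d, MassStat.weight (-u +ᵥ y).2 u *
          g (-u +ᵥ y) (u - MassStat.toSpace (MassStat.centre (-u +ᵥ y).2))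
            ∂volume ∂(P₀.map Y₀) := by
    intro g hg
    rw [← MassStat.lintegral_changed hY₀ hT hS hTlaw hSlaw' hfin hocc hQ hg, hPeq]
    exact lintegral_congr fun ω => congrArg (fun z => g z (T ω)) (congrFun hYeq ω)
  have hinv : MassStat.IsInversion (P₀.map Y₀) (P.map fun ω => (X ω, ξ ω)) := fun f hf => by
    rw [lintegral_map hf hY]
    exact hjoint (fun z _ => f z) (hf.comp measurable_fst)
  -- Thus S is almost everywhere a function of ξ, so that the claimed conditional distribution of T
  -- is a kernel in (X, ξ).
  have hcentre : ∀ᵐ ω ∂P, MassStat.centre (ξ ω) = -S ω := by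
    refine hac.ae_le ?_
    filter_upwards [hocc, hcell] with ω h1 h2
    rw [hξ]
    exact MassStat.centre_shift ((MassStat.mem_originCell_iff h1 _).1 h2)
  have hm : Measurable fun z : E × MassStat.LFMeasure d =>
      MassStat.toSpace (MassStat.centre z.2) +ᵥ z.2 :=
    (MassStat.measurable_toSpace.comp
      (MassStat.measurable_centre.comp measurable_snd)).vadd measurable_snd
  refine ⟨hinv.sigmaFinite hex hQ hM0, fun t => ?_, ⟨?_, fun A B hA hB => ?_⟩, ?_⟩
  · refine ⟨((measurable_const_vadd t).comp hY).aemeasurable, hY.aemeasurable, ?_⟩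
    refine Measure.ext_of_lintegral _ fun f hf => ?_
    have h := hinv.lintegral_vadd hex hQ hM0 t hf
    have h1 := lintegral_map (μ := P) (f := fun z => f (t +ᵥ z))
      (hf.comp (measurable_const_vadd t)) hY
    have h2 := lintegral_map (μ := P) hf ((measurable_const_vadd t).comp hY)
    exact h2.trans (h1.symm.trans h)
  · refine ⟨(MassStat.condKernel MassStat.measurableSet_unitCube).comap _ hm,
      hcentre.mono fun ω hω => ?_⟩
    rw [Kernel.comap_apply, MassStat.condKernel_apply, hω, MassStat.toSpace_neg]
  · let g : E × MassStat.LFMeasure d → MassStat.Space d → ℝ≥0∞ := fun z v =>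
      (A ×ˢ B).indicator 1 (z, v)
    have hg : Measurable (Function.uncurry g) := measurable_one.indicator (hA.prod hB)
    let K := (MassStat.condKernel (d := d) MassStat.measurableSet_unitCube).comap _ hm
    have hK : ∀ z, ∫⁻ v, g z v ∂(K z) = A.indicator (fun z => K z B) z := by
      intro z
      by_cases hz : z ∈ A
      · rw [Set.indicator_of_mem hz, ← lintegral_indicator_one hB]
        refine lintegral_congr fun v => ?_
        by_cases hv : v ∈ B <;> simp [g, hz, hv]
      · rw [Set.indicator_of_notMem hz, ← lintegral_zero]
        refine lintegral_congr fun v => ?_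
        simp [g, hz]
    have hKm : Measurable fun z => A.indicator (fun z => K z B) z :=
      (K.measurable_coe hB).indicator hA
    calc P ((fun ω => (X ω, ξ ω)) ⁻¹' A ∩ T ⁻¹' B)
        = ∫⁻ ω, g (X ω, ξ ω) (T ω) ∂P := by
          rw [← lintegral_indicator_one ((hY hA).inter (hT hB))]
          refine lintegral_congr fun ω => ?_
          by_cases h1 : (X ω, ξ ω) ∈ A <;> by_cases h2 : T ω ∈ B <;> simp [g, h1, h2]
      _ = ∫⁻ z, A.indicator (fun z => K z B) z ∂(P.map fun ω => (X ω, ξ ω)) := by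
          rw [hjoint g hg, hinv.lintegral_cond hex hQ hg]
          exact lintegral_congr hK
      _ = ∫⁻ ω in (fun ω => (X ω, ξ ω)) ⁻¹' A, K (X ω, ξ ω) B ∂P := by
          rw [lintegral_map hKm hY, ← lintegral_indicator (hY hA)]
          rfl
      _ = _ := by
          refine lintegral_congr_ae (ae_restrict_of_ae (hcentre.mono fun ω hω => ?_))
          simp only [K]
          rw [Kernel.comap_apply, MassStat.condKernel_apply, hω, MassStat.toSpace_neg]
  · intro f hf B hB hB0 hB1
    have h := hinv.lintegral_palm hex hQ hf hB
    rw [lintegral_map hf hY₀, lintegral_map _ hY] at h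
    · rw [ENNReal.eq_div_iff hB0.ne' hB1.ne, mul_comm]
      exact h.symm
    · simp only [← lintegral_indicator hB]
      refine MassStat.measurable_lintegral_snd
        (g := fun z x => B.indicator (fun x => f (x +ᵥ z)) x) ?_
      exact MassStat.measurable_indicator_vadd hf hB
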